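/- Let $d,p\ge 1$ and let $\mathbf Y(t)=(Y_1(t),\dots,Y_d(t))$, $t\in\mathbb R^p$, be an $\mathbb R^d$-valued Gaussian process with centered components and continuous sample paths. Put $Z_i(t)=\exp\bigl(Y_i(t)-\tfrac12\operatorname{Var}(Y_i(t))\bigr)$, $1\le i\le d$. Let $\mathbf X(t)=(X_1(t),\dots,X_d(t))$, $t\in\mathbb R^p$, be an associated Brown–Resnick process, i.e. a process with continuous $[0,\infty)^d$-valued sample paths that has the same law as $$\max_{m\ge 1}\Gamma_m^{-1}\mathbf Z^{(m)}(t),\qquad t\in\mathbb R^p \quad\text{(componentwise maximum)},$$ where $\Gamma_m=E_1+\dots+E_m$, the $E_k$ are independent unit exponential random variables, and the $\mathbf Z^{(m)}$ are independent copies of $\mathbf Z=(Z_1,\dots,Z_d)$, independent of $(E_k)_{k\ge1}$. Let $\gamma_{ij}(t,s)=\operatorname{Var}(Y_i(t)-Y_j(s))$ for $s,t\in\mathbb R^p$, $1\le i,j\le d$. (The law of a process is its law on the $\sigma$-field generated by the coordinate projections.) 1. The law of $\mathbf X$ depends only on the functions $\gamma_{ij}$: if $\mathbf X$ and $\mathbf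 X'$ are Brown–Resnick processes associated with $\mathbf Y$ and $\mathbf Y'$, respectively, and $\operatorname{Var}(Y_i(t)-Y_j(s))=\operatorname{Var}(Y'_i(t)-Y'_j(s))$ for all $i,j\le d$ and $s,t\in\mathbb R^p$, then $\mathbf X$ and $\mathbf X'$ have the same law. 2. If every $\gamma_{ij}(t,s)$, $i,j\le d$, depends only on the difference $t-s$, then $\mathbf X$ is stationary, i.e. $(\mathbf X(t-h))_{t\in\mathbb R^p}$ and $(\mathbf X(t))_{t\in\mathbb R^p}$ have the same law for every $h\in\mathbb R^p$. 3. Let $t_1,\dots,t_n\in\mathbb R^p$ and $\mathbf x_j=(x_{1j},\dots,x_{dj})\in(0,\infty)^d$, $1\le j\le n$, and suppose that the random vector $(\mathbf Y(t_1),\dots,\mathbf Y(t_n))$ in $\mathbb R^{dn}$ possesses a density with respect to Lebesgue measure. With $J=\{(i,j):1\le i\le d,\ 1\le j\le n\}$, the probability $\mathbb P(\mathbf X(t_j)\le\mathbf x_j,\ 1\le j\le n)$ is positive and $$-\ln\mathbb P\bigl(\mathbf X(t_j)\le \mathbf x_j,\ 1\le j\le n\bigr)=\sum_{(k,l)\in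 J}\frac1{x_{kl}}\,\mathbb P\Bigl(\forall (i,j)\in J\setminus\{(k,l)\}:\ Y_i(t_j)-Y_k(t_l)-\tfrac12\operatorname{Var}\bigl(Y_i(t_j)-Y_k(t_l)\bigr)\le\ln\frac{x_{ij}}{x_{kl}}\Bigr).$$ -/

import Mathlib

open MeasureTheory ProbabilityTheory

noncomputable section

namespace BrownResnick

/-- The parameter space `ℝᵖ`. -/
abbrev Param (p : ℕ) : Type := EuclideanSpace ℝ (Fin p)

/-- The space of all functions `ℝᵖ → ℝᵈ`, carrying the (product) σ-field generated by the
projections `f ↦ f t`. -/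
abbrev PathSpace (p d : ℕ) : Type := Param p → Fin d → ℝ

/-- The law of an `ℝᵈ`-valued process with index set `ℝᵖ`, on the σ-field generated by the
projections. -/
def processLaw {p d : ℕ} {Ω : Type*} [MeasurableSpace Ω]
    (X : Param p → Ω → Fin d → ℝ) (P : Measure Ω) : Measure (PathSpace p d) :=
  P.map (fun ω t => X t ω)

/-- `X` is a random process all of whose sample paths belong to the space `C` of continuous
functions `ℝᵖ → [0,∞)ᵈ`. -/
structure HasPathsInC {p d : ℕ} {Ω : Type*} [MeasurableSpace Ω]
    (X : Param p → Ω → Fin d → ℝ) : Prop where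
  measurable : ∀ t, Measurable (X t)
  continuous : ∀ ω, Continuous (fun t => X t ω)
  nonneg : ∀ t ω i, 0 ≤ X t ω i

/-- `Γₖ = E₀ + ⋯ + Eₖ`, the partial sums (indices start at `0`). -/
def arrival (e : ℕ → ℝ) (k : ℕ) : ℝ := ∑ j ∈ Finset.range (k + 1), e j

/-- The componentwise maximum `t ↦ maxₖ Γₖ^(-1/α) z⁽ᵏ⁾(t)` as a function of the sequences `(Eₖ)`
and `(z⁽ᵏ⁾)`. The maximum is almost surely finite (and attained) whenever the components of the
spectral process have finite moments of order `α`, as is the case for log-Gaussian ones. -/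
def deHaanMax {p d : ℕ} (α : ℝ) (w : (ℕ → ℝ) × (ℕ → PathSpace p d)) : PathSpace p d :=
  fun t i => ⨆ k : ℕ, arrival w.1 k ^ (-1 / α) * w.2 k t i

lemma measurable_deHaanMax {p d : ℕ} (α : ℝ) :
    Measurable (deHaanMax (p := p) (d := d) α) := by
  refine measurable_pi_lambda _ fun t => measurable_pi_lambda _ fun i => ?_
  refine Measurable.iSup fun k => Measurable.mul ?_ ?_
  · refine Measurable.pow_const ?_ _
    exact Finset.measurable_sum _ fun j _ => (measurable_pi_apply j).comp measurable_fst
  · exact (measurable_pi_apply i).comp ((measurable_pi_apply t).comp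
      ((measurable_pi_apply k).comp measurable_snd))

/-- The law of `maxₖ Γₖ^(-1/α) Z⁽ᵏ⁾(t)`, `t ∈ ℝᵖ`, where the `Eₖ` are independent unit exponential
random variables, independent of the `Z⁽ᵏ⁾`, which are independent processes with law `ν`. -/
def deHaanLaw {p d : ℕ} (α : ℝ) (ν : Measure (PathSpace p d)) : Measure (PathSpace p d) :=
  ((Measure.infinitePi fun _ : ℕ => expMeasure 1).prod
    (Measure.infinitePi fun _ : ℕ => ν)).map (deHaanMax α)

/-- `X` is a max-stable process with paths in `C` and spectral process `Z` (whose paths are in `C`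
too): it has, in distribution, the de Haan representation `X(t) = maxₖ Γₖ^(-1/α) Z⁽ᵏ⁾(t)`. -/
structure IsMaxStableWithSpectralProcess {p d : ℕ} {Ω Ω' : Type*} [MeasurableSpace Ω]
    [MeasurableSpace Ω'] (α : ℝ) (X : Param p → Ω → Fin d → ℝ) (P : Measure Ω)
    (Z : Param p → Ω' → Fin d → ℝ) (Q : Measure Ω') : Prop where
  paths : HasPathsInC X
  spectral_paths : HasPathsInC Z
  law_eq : processLaw X P = deHaanLaw α (processLaw Z Q)

/-- The log-Gaussian process with components `exp (Yᵢ(t) - Var(Yᵢ(t)) / 2)`. -/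
def logGaussian {p d : ℕ} {Ω : Type*} [MeasurableSpace Ω]
    (Y : Param p → Ω → Fin d → ℝ) (Q : Measure Ω) : Param p → Ω → Fin d → ℝ :=
  fun t ω i => Real.exp (Y t ω i - variance (fun ω' => Y t ω' i) Q / 2)

/-- `X` is a Brown–Resnick max-stable process built from the centered Gaussian process `Y`. -/
structure IsBrownResnick {p d : ℕ} {Ω Ω' : Type*} [MeasurableSpace Ω] [MeasurableSpace Ω']
    (X : Param p → Ω → Fin d → ℝ) (P : Measure Ω)
    (Y : Param p → Ω' → Fin d → ℝ) (Q : Measure Ω') : Prop where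
  gaussian : IsGaussianProcess Y Q
  centered : ∀ t i, ∫ ω, Y t ω i ∂Q = 0
  maxStable : IsMaxStableWithSpectralProcess 1 X P (logGaussian Y Q) Q

/-- The cross-variogram `γᵢⱼ(t,s) = Var(Yᵢ(t) - Yⱼ(s))`. -/
def crossVariogram {p d : ℕ} {Ω : Type*} [MeasurableSpace Ω]
    (Y : Param p → Ω → Fin d → ℝ) (Q : Measure Ω) (i j : Fin d) (t s : Param p) : ℝ :=
  variance (fun ω => Y t ω i - Y s ω j) Q

/-- Stationarity: for every `h`, the shifted process `t ↦ X(t - h)` has the same law as `X`. -/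
def IsStationary {p d : ℕ} {Ω : Type*} [MeasurableSpace Ω]
    (X : Param p → Ω → Fin d → ℝ) (P : Measure Ω) : Prop :=
  ∀ h : Param p, processLaw (fun t => X (t - h)) P = processLaw X P

end BrownResnick

end

/-!
For a mark `φ ≥ 0` with `E φ < ∞`, the probability that every point of the marked Poisson process
satisfies `φ (zₖ) ≤ Γₖ` is `exp (-E φ)`: with `T` the tail function of `φ`, conditioning on the
first point shows that `s ↦ exp (-∫ₛ^∞ T)`, multiplied by the indicator that the first `N` points
comply, is a martingale along `s + Γ_N`; let `N → ∞`. Hence the finite-dimensional distribution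
functions of the de Haan process are `exp (-E max_b (Z_b / x_b) ^ α)`.

In the log-Gaussian case the density `exp (Y_a - Var Y_a / 2)` shifts each `Y_b` by `Cov(Y_b, Y_a)`
(Cameron–Martin). Pulling the factor of index `a` out of the maximum therefore replaces `Y_b` by
`Y_b - Y_a` and `Var Y_b` by `Var(Y_b - Y_a)`, so the exponent depends on the variogram only, and
shifting the index preserves a stationary variogram. If the increments are nondegenerate, the
maximum is almost surely attained at exactly one index `a`; splitting the expectation accordingly
and tilting by the factor of index `a` in each part gives the explicit sum.
-/

noncomputable section

namespace BrownResnick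

open Set Filter Topology

section ExponentialTail

lemma integral_Ioi_of_hasDerivAt_off_countable_of_tendsto {E : Type*} [NormedAddCommGroup E]
    [NormedSpace ℝ E] [CompleteSpace E] {f f' : ℝ → E} {a : ℝ} {m : E} {s : Set ℝ}
    (hs : s.Countable) (hcont : ContinuousOn f (Ici a))
    (hderiv : ∀ x ∈ Ioi a \ s, HasDerivAt f (f' x) x) (f'int : IntegrableOn f' (Ioi a))
    (hf : Tendsto f atTop (𝓝 m)) : ∫ x in Ioi a, f' x = m - f a := by
  refine tendsto_nhds_unique (intervalIntegral_tendsto_integral_Ioi a f'int tendsto_id) ?_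
  refine (hf.sub_const (f a)).congr' ?_
  filter_upwards [eventually_ge_atTop a] with b hab
  refine (integral_eq_of_hasDerivAt_off_countable_of_le f f' hab hs
    (hcont.mono Icc_subset_Ici_self) (fun x hx => hderiv x ⟨hx.1.1, hx.2⟩) ?_).symm
  rw [intervalIntegrable_iff_integrableOn_Ioc_of_le hab]
  exact f'int.mono_set Ioc_subset_Ioi_self

lemma integral_Ioi_eq_sub_intervalIntegral {E : Type*} [NormedAddCommGroup E] [NormedSpace ℝ E]
    {f : ℝ → E} (hf : ∀ a, IntegrableOn f (Ioi a)) (a s : ℝ) :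
    ∫ u in Ioi s, f u = (∫ u in Ioi a, f u) - ∫ u in a..s, f u := by
  rw [← intervalIntegral.integral_Ioi_sub_Ioi' (hf a) (hf s), sub_sub_cancel]

/-- The function `s ↦ exp (-∫ₛ^∞ T)`. When `T` is the tail function of a mark `φ`, it is the
probability that no point `(Γₖ, φ (zₖ))` of a marked unit-rate Poisson process satisfies
`s + Γₖ < φ (zₖ)`. -/
def expNegTail (T : ℝ → ℝ) (s : ℝ) : ℝ :=
  Real.exp (-∫ u in Ioi s, T u)

variable {T : ℝ → ℝ}

lemma expNegTail_nonneg (T : ℝ → ℝ) (s : ℝ) : 0 ≤ expNegTail T s := (Real.exp_pos _).le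

lemma expNegTail_le_one (hT0 : ∀ u, 0 ≤ T u) (s : ℝ) : expNegTail T s ≤ 1 := by
  rw [expNegTail, Real.exp_le_one_iff, neg_nonpos]
  exact integral_nonneg hT0

lemma continuous_expNegTail (hT : ∀ a, IntegrableOn T (Ioi a)) : Continuous (expNegTail T) := by
  have hprim : Continuous fun s => ∫ u in (0 : ℝ)..s, T u :=
    intervalIntegral.continuous_primitive (fun a b =>
      ⟨(hT a).mono_set Ioc_subset_Ioi_self, (hT b).mono_set Ioc_subset_Ioi_self⟩) 0
  have htail : Continuous fun s => (∫ u in Ioi 0, T u) - ∫ u in (0 : ℝ)..s, T u :=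
    continuous_const.sub hprim
  simp_rw [← integral_Ioi_eq_sub_intervalIntegral hT] at htail
  exact Real.continuous_exp.comp htail.neg

lemma tendsto_expNegTail_atTop (hT : ∀ a, IntegrableOn T (Ioi a)) :
    Tendsto (expNegTail T) atTop (𝓝 1) := by
  have htail := (intervalIntegral_tendsto_integral_Ioi 0 (hT 0) tendsto_id).const_sub
    (∫ u in Ioi 0, T u)
  simp_rw [id, ← integral_Ioi_eq_sub_intervalIntegral hT, sub_self] at htail
  simpa using! (Real.continuous_exp.tendsto _).comp htail.neg

lemma hasDerivAt_expNegTail (hT : ∀ a, IntegrableOn T (Ioi a)) (hTm : StronglyMeasurable T)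
    {s : ℝ} (hs : ContinuousAt T s) :
    HasDerivAt (expNegTail T) (expNegTail T s * T s) s := by
  have hprim : HasDerivAt (fun u => ∫ x in (0 : ℝ)..u, T x) (T s) s :=
    intervalIntegral.integral_hasDerivAt_right
      ⟨(hT 0).mono_set Ioc_subset_Ioi_self, (hT s).mono_set Ioc_subset_Ioi_self⟩
      hTm.stronglyMeasurableAtFilter hs
  have htail := hprim.const_sub (∫ u in Ioi 0, T u)
  simp_rw [← integral_Ioi_eq_sub_intervalIntegral hT 0] at htail
  simpa using! htail.neg.exp

lemma integrableOn_exp_neg_mul_expNegTail (hT : ∀ a, IntegrableOn T (Ioi a)) (hTm : Measurable T)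
    (hT0 : ∀ u, 0 ≤ T u) (hT1 : ∀ u, T u ≤ 1) (s : ℝ) :
    IntegrableOn (fun e => Real.exp (-e) * (expNegTail T (s + e) * (1 - T (s + e)))) (Ioi 0) := by
  have hG := (continuous_expNegTail hT).measurable
  refine Integrable.mono' (integrableOn_exp_neg_Ioi 0)
    (Measurable.aestronglyMeasurable (by fun_prop)) (Eventually.of_forall fun e => ?_)
  rw [Real.norm_of_nonneg (mul_nonneg (Real.exp_pos _).le
    (mul_nonneg (expNegTail_nonneg _ _) (sub_nonneg.2 (hT1 _))))]
  exact mul_le_of_le_one_right (Real.exp_pos _).le <|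
    mul_le_one₀ (expNegTail_le_one hT0 _) (sub_nonneg.2 (hT1 _)) (sub_le_self _ (hT0 _))

lemma integral_exp_neg_mul_expNegTail (hT : ∀ a, IntegrableOn T (Ioi a)) (hTanti : Antitone T)
    (hT0 : ∀ u, 0 ≤ T u) (hT1 : ∀ u, T u ≤ 1) (s : ℝ) :
    ∫ e in Ioi 0, Real.exp (-e) * (expNegTail T (s + e) * (1 - T (s + e))) = expNegTail T s := by
  have hG := continuous_expNegTail hT
  have hderiv : ∀ e, ContinuousAt T (s + e) →
      HasDerivAt (fun e => -(Real.exp (-e) * expNegTail T (s + e)))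
        (Real.exp (-e) * (expNegTail T (s + e) * (1 - T (s + e)))) e := by
    intro e he
    have hG' := HasDerivAt.comp_const_add s e
      (hasDerivAt_expNegTail hT hTanti.measurable.stronglyMeasurable he)
    convert! ((hasDerivAt_neg e).exp.mul hG').neg using 1
    ring
  have hlim : Tendsto (fun e => -(Real.exp (-e) * expNegTail T (s + e))) atTop (𝓝 0) := by
    simpa using (Real.tendsto_exp_neg_atTop_nhds_zero.mul ((tendsto_expNegTail_atTop hT).comp
      (tendsto_atTop_add_const_left _ s tendsto_id))).neg
  rw [integral_Ioi_of_hasDerivAt_off_countable_of_tendsto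
    (hTanti.countable_not_continuousAt.preimage (add_right_injective s))
    (Continuous.continuousOn (by fun_prop)) (fun e he => hderiv e (not_not.1 he.2))
    (integrableOn_exp_neg_mul_expNegTail hT hTanti.measurable hT0 hT1 s) hlim]
  simp

instance isProbabilityMeasure_expMeasure_one : IsProbabilityMeasure (expMeasure 1) :=
  isProbabilityMeasure_expMeasure one_pos

lemma lintegral_expMeasure {r : ℝ} {f : ℝ → ENNReal} (hf : Measurable f) :
    ∫⁻ e, f e ∂expMeasure r =
      ∫⁻ e in Ioi 0, ENNReal.ofReal (r * Real.exp (-(r * e))) * f e := by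
  have hpdf : Measurable (exponentialPDF r) := (measurable_exponentialPDFReal r).ennreal_ofReal
  have hneg : ∀ e ∈ (Ici (0 : ℝ))ᶜ, (exponentialPDF r * f) e = 0 := fun e he => by
    simp [exponentialPDF_of_neg (r := r) (not_le.1 he)]
  rw [show expMeasure r = volume.withDensity (exponentialPDF r) from rfl,
    lintegral_withDensity_eq_lintegral_mul _ hpdf hf,
    ← lintegral_add_compl _ (measurableSet_Ici (a := (0 : ℝ))),
    setLIntegral_congr_fun measurableSet_Ici.compl hneg, lintegral_zero, add_zero,
    setLIntegral_congr Ioi_ae_eq_Ici.symm]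
  refine setLIntegral_congr_fun measurableSet_Ioi fun e he => ?_
  rw [Pi.mul_apply, exponentialPDF_of_nonneg (le_of_lt he)]

lemma ae_pos_expMeasure (r : ℝ) : ∀ᵐ e ∂expMeasure r, 0 < e := by
  have h := lintegral_expMeasure (r := r) (f := (Iic (0 : ℝ)).indicator 1)
    (measurable_one.indicator measurableSet_Iic)
  rw [lintegral_indicator_one measurableSet_Iic,
    setLIntegral_congr_fun (g := fun _ => 0) measurableSet_Ioi, lintegral_zero] at h
  · simpa [ae_iff, ← Iic_def] using h
  · intro e he
    simp [not_le.2 (mem_Ioi.1 he)]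

lemma lintegral_expNegTail_mul_one_sub (hT : ∀ a, IntegrableOn T (Ioi a)) (hTanti : Antitone T)
    (hT0 : ∀ u, 0 ≤ T u) (hT1 : ∀ u, T u ≤ 1) (s : ℝ) :
    ∫⁻ e, ENNReal.ofReal (expNegTail T (s + e) * (1 - T (s + e))) ∂expMeasure 1 =
      ENNReal.ofReal (expNegTail T s) := by
  have hG := (continuous_expNegTail hT).measurable
  have hTm := hTanti.measurable
  rw [lintegral_expMeasure (by fun_prop), ← integral_exp_neg_mul_expNegTail hT hTanti hT0 hT1 s,
    ofReal_integral_eq_lintegral_ofReal (integrableOn_exp_neg_mul_expNegTail hT hTm hT0 hT1 s)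
      (Eventually.of_forall fun e => mul_nonneg (Real.exp_pos _).le
        (mul_nonneg (expNegTail_nonneg _ _) (sub_nonneg.2 (hT1 _))))]
  simp only [one_mul, ENNReal.ofReal_mul (Real.exp_pos _).le]

end ExponentialTail

section InfiniteProduct

variable {α : Type*} [MeasurableSpace α]

lemma measurePreserving_natCases_infinitePi (ν : Measure α) [IsProbabilityMeasure ν] :
    MeasurePreserving (fun (q : α × (ℕ → α)) n => Nat.casesOn n q.1 q.2)
      (ν.prod (Measure.infinitePi fun _ => ν)) (Measure.infinitePi fun _ => ν) := by
  have hmeas : Measurable fun (q : α × (ℕ → α)) (n : ℕ) => (Nat.casesOn n q.1 q.2 : α) := by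
    refine measurable_pi_lambda _ fun n => ?_
    cases n <;> fun_prop
  refine ⟨hmeas, Measure.eq_infinitePi _ fun s t ht => ?_⟩
  obtain ⟨N, hN⟩ := s.exists_nat_subset_range
  have hs : s ⊆ Finset.range (N + 1) := hN.trans (Finset.range_mono N.le_succ)
  set u : ℕ → Set α := fun n => if n ∈ s then t n else univ with hu
  have hum : ∀ n, MeasurableSet (u n) := fun n => by
    simp only [hu]; split_ifs with h <;> simp [ht]
  have hpre : (fun (q : α × (ℕ → α)) n => (Nat.casesOn n q.1 q.2 : α)) ⁻¹' (s : Set ℕ).pi t =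
      u 0 ×ˢ (Finset.range N : Set ℕ).pi fun n => u (n + 1) := by
    ext ⟨a, w⟩
    simp only [mem_preimage, Set.mem_pi, mem_prod, Finset.mem_coe, Finset.mem_range, hu]
    refine ⟨fun h => ⟨?_, fun n _ => ?_⟩, fun h n hn => ?_⟩
    · split_ifs with h0
      exacts [h 0 h0, mem_univ a]
    · split_ifs with hn
      exacts [h (n + 1) hn, mem_univ _]
    · cases n with
      | zero => simpa [hn] using h.1
      | succ n => simpa [hn] using h.2 n (by have := Finset.mem_range.1 (hN hn); omega)
  rw [Measure.map_apply hmeas (.pi s.countable_toSet fun i _ => ht i), hpre, Measure.prod_prod,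
    Measure.infinitePi_pi _ fun n _ => hum (n + 1), mul_comm,
    ← Finset.prod_range_succ' (fun n => ν (u n)), ← Finset.prod_subset hs]
  · exact Finset.prod_congr rfl fun n hn => by simp [hu, hn]
  · intro n _ hn
    simp [hu, hn]

lemma measurePreserving_head_tail_infinitePi (ν : Measure α) [IsProbabilityMeasure ν] :
    MeasurePreserving (fun w : ℕ → α => (w 0, fun n => w (n + 1)))
      (Measure.infinitePi fun _ => ν) (ν.prod (Measure.infinitePi fun _ => ν)) := by
  refine ⟨by fun_prop, ?_⟩
  have hcons := measurePreserving_natCases_infinitePi ν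
  conv_lhs => rw [← hcons.map_eq, Measure.map_map (by fun_prop) hcons.measurable]
  exact Measure.map_id

end InfiniteProduct

lemma ae_tendsto_sum_atTop_of_ae_pos {Ω : Type*} [MeasurableSpace Ω] {μ : Measure Ω}
    [IsProbabilityMeasure μ] {X : ℕ → Ω → ℝ} (hpos : ∀ᵐ ω ∂μ, 0 < X 0 ω)
    (hindep : Pairwise fun i j => IndepFun (X i) (X j) μ)
    (hident : ∀ i, IdentDistrib (X i) (X 0) μ μ) :
    ∀ᵐ ω ∂μ, Tendsto (fun N => ∑ k ∈ Finset.range N, X k ω) atTop atTop := by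
  have htrunc : Measurable fun x : ℝ => min x 1 := by fun_prop
  have hpos' : ∀ᵐ ω ∂μ, 0 < min (X 0 ω) 1 := hpos.mono fun ω h => lt_min h one_pos
  have hint : Integrable (fun ω => min (X 0 ω) 1) μ := by
    refine Integrable.of_bound
      (htrunc.comp_aemeasurable (hident 0).aemeasurable_fst).aestronglyMeasurable 1 ?_
    filter_upwards [hpos'] with ω h
    rw [Real.norm_of_nonneg h.le]
    exact min_le_right _ _
  have hmean : 0 < ∫ ω, min (X 0 ω) 1 ∂μ := by
    refine (integral_nonneg_of_ae (hpos'.mono fun _ h => h.le)).lt_of_ne' fun h0 => ?_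
    rw [integral_eq_zero_iff_of_nonneg_ae (hpos'.mono fun _ h => h.le) hint] at h0
    obtain ⟨ω, h1, h2⟩ := (h0.and hpos').exists
    exact h2.ne' h1
  have hslln := strong_law_ae_real (fun k ω => min (X k ω) 1) hint
    (fun i j hij => (hindep hij).comp htrunc htrunc) (fun i => (hident i).comp htrunc)
  filter_upwards [hslln] with ω hω
  refine tendsto_atTop_mono' _ ?_ (hω.pos_mul_atTop hmean tendsto_natCast_atTop_atTop)
  filter_upwards [eventually_gt_atTop 0] with N hN
  rw [div_mul_cancel₀ _ (Nat.cast_ne_zero.2 hN.ne')]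
  exact Finset.sum_le_sum fun k _ => min_le_left _ _

section MarkedPoisson

variable {S : Type*} [MeasurableSpace S]

/-- The joint law of i.i.d. unit exponential waiting times `Eₖ` and of an independent sequence of
i.i.d. marks `zₖ` with law `ν`; the points `(Γₖ, zₖ)` form a marked unit-rate Poisson process. -/
abbrev markedLaw (ν : Measure S) : Measure ((ℕ → ℝ) × (ℕ → S)) :=
  (Measure.infinitePi fun _ : ℕ => expMeasure 1).prod (Measure.infinitePi fun _ : ℕ => ν)

lemma measurable_arrival (k : ℕ) : Measurable fun e : ℕ → ℝ => arrival e k := by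
  unfold arrival; fun_prop

lemma arrival_succ_eq_add (e : ℕ → ℝ) (k : ℕ) :
    arrival e (k + 1) = e 0 + arrival (fun n => e (n + 1)) k := by
  rw [arrival, Finset.sum_range_succ', add_comm, arrival]

section

variable (ν : Measure S) [IsProbabilityMeasure ν]

lemma lintegral_markedLaw_head_tail {F : ℝ → S → (ℕ → ℝ) × (ℕ → S) → ENNReal}
    (hF : Measurable fun q : ℝ × S × (ℕ → ℝ) × (ℕ → S) => F q.1 q.2.1 q.2.2) :
    ∫⁻ w, F (w.1 0) (w.2 0) (fun n => w.1 (n + 1), fun n => w.2 (n + 1)) ∂markedLaw ν =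
      ∫⁻ e, ∫⁻ z, ∫⁻ w, F e z w ∂markedLaw ν ∂ν ∂expMeasure 1 := by
  have hsplit := (measurePreserving_head_tail_infinitePi (expMeasure 1)).prod
    (measurePreserving_head_tail_infinitePi ν)
  have hF' : Measurable fun q : (ℝ × (ℕ → ℝ)) × S × (ℕ → S) => F q.1.1 q.2.1 (q.1.2, q.2.2) :=
    hF.comp (f := fun q : (ℝ × (ℕ → ℝ)) × S × (ℕ → S) => (q.1.1, q.2.1, q.1.2, q.2.2)) (by fun_prop)
  have hFez : ∀ e, Measurable fun q : S × (ℕ → ℝ) × (ℕ → S) => F e q.1 q.2 := fun e => by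
    fun_prop
  calc ∫⁻ w, F (w.1 0) (w.2 0) (fun n => w.1 (n + 1), fun n => w.2 (n + 1)) ∂markedLaw ν
      = ∫⁻ e, ∫⁻ u, ∫⁻ z, ∫⁻ v, F e z (u, v) ∂Measure.infinitePi (fun _ => ν) ∂ν
          ∂Measure.infinitePi (fun _ => expMeasure 1) ∂expMeasure 1 := by
        refine (hsplit.lintegral_comp hF').trans ?_
        rw [lintegral_prod _ (by fun_prop), lintegral_prod _ (by fun_prop)]
        refine lintegral_congr fun e => lintegral_congr fun u => ?_
        rw [lintegral_prod _ (by fun_prop)]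
    _ = ∫⁻ e, ∫⁻ z, ∫⁻ u, ∫⁻ v, F e z (u, v) ∂Measure.infinitePi (fun _ => ν)
          ∂Measure.infinitePi (fun _ => expMeasure 1) ∂ν ∂expMeasure 1 := by
        refine lintegral_congr fun e => lintegral_lintegral_swap ?_
        have hswap : Measurable fun q : ((ℕ → ℝ) × S) × (ℕ → S) => F e q.1.2 (q.1.1, q.2) :=
          (hFez e).comp (f := fun q : ((ℕ → ℝ) × S) × (ℕ → S) => (q.1.2, q.1.1, q.2))
            (by fun_prop)
        exact hswap.lintegral_prod_right'.aemeasurable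
    _ = ∫⁻ e, ∫⁻ z, ∫⁻ w, F e z w ∂markedLaw ν ∂ν ∂expMeasure 1 := by
        refine lintegral_congr fun e => lintegral_congr fun z => ?_
        rw [lintegral_prod _ (by fun_prop)]

lemma ae_pos_markedLaw : ∀ᵐ w ∂markedLaw ν, ∀ k, 0 < w.1 k := by
  refine ae_all_iff.2 fun k => ?_
  exact ((measurePreserving_eval_infinitePi (fun _ : ℕ => expMeasure 1) k).comp
    measurePreserving_fst).quasiMeasurePreserving.ae (ae_pos_expMeasure 1)

lemma ae_arrival_pos : ∀ᵐ w ∂markedLaw ν, ∀ k, 0 < arrival w.1 k := by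
  filter_upwards [ae_pos_markedLaw ν] with w hw k
  exact Finset.sum_pos (fun j _ => hw j) Finset.nonempty_range_add_one

lemma ae_tendsto_sum_markedLaw :
    ∀ᵐ w ∂markedLaw ν, Tendsto (fun N => ∑ k ∈ Finset.range N, w.1 k) atTop atTop := by
  have heval := measurePreserving_eval_infinitePi fun _ : ℕ => expMeasure 1
  have hindep := iIndepFun_infinitePi (P := fun _ : ℕ => expMeasure 1) (X := fun _ e => e)
    fun _ => measurable_id
  have hsum := ae_tendsto_sum_atTop_of_ae_pos (X := fun k (e : ℕ → ℝ) => e k)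
    ((heval 0).quasiMeasurePreserving.ae (ae_pos_expMeasure 1))
    (fun i j hij => hindep.indepFun hij) fun k =>
      ⟨(heval k).measurable.aemeasurable, (heval 0).measurable.aemeasurable,
        (heval k).map_eq.trans (heval 0).map_eq.symm⟩
  exact measurePreserving_fst.quasiMeasurePreserving.ae hsum

end

/-- The tail function `u ↦ ν (φ > u)` of a mark `φ` with respect to the law `ν`. -/
def tailProb (ν : Measure S) (φ : S → ℝ) (u : ℝ) : ℝ := ν.real {z | u < φ z}

variable {ν : Measure S} {φ : S → ℝ}

lemma tailProb_nonneg (ν : Measure S) (φ : S → ℝ) (u : ℝ) : 0 ≤ tailProb ν φ u := measureReal_nonneg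

lemma tailProb_le_one [IsProbabilityMeasure ν] (φ : S → ℝ) (u : ℝ) : tailProb ν φ u ≤ 1 :=
  measureReal_le_one

lemma ofReal_tailProb [IsFiniteMeasure ν] (φ : S → ℝ) (u : ℝ) :
    ENNReal.ofReal (tailProb ν φ u) = ν {z | u < φ z} :=
  ofReal_measureReal

lemma antitone_tailProb [IsFiniteMeasure ν] (φ : S → ℝ) : Antitone (tailProb ν φ) :=
  fun _ _ huv => measureReal_mono fun _ hz => huv.trans_lt hz

lemma measure_le_eq_ofReal_one_sub_tailProb [IsProbabilityMeasure ν] (hφ : Measurable φ)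
    (u : ℝ) :
    ν {z | φ z ≤ u} = ENNReal.ofReal (1 - tailProb ν φ u) := by
  have hcompl : {z | φ z ≤ u} = {z | u < φ z}ᶜ := by ext; simp
  rw [hcompl, tailProb, ← probReal_compl_eq_one_sub (measurableSet_lt measurable_const hφ),
    ofReal_measureReal]

lemma integrableOn_tailProb_Ioi [IsFiniteMeasure ν] (hφ0 : 0 ≤ᵐ[ν] φ) (hint : Integrable φ ν)
    (a : ℝ) : IntegrableOn (tailProb ν φ) (Ioi a) := by
  have hIoi : IntegrableOn (tailProb ν φ) (Ioi 0) := by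
    refine ⟨(antitone_tailProb φ).measurable.aestronglyMeasurable, ?_⟩
    rw [hasFiniteIntegral_iff_ofReal (Eventually.of_forall (tailProb_nonneg ν φ))]
    simp_rw [ofReal_tailProb]
    rw [← lintegral_eq_lintegral_meas_lt ν hφ0 hint.aemeasurable]
    exact hint.lintegral_lt_top
  refine ((antitone_tailProb φ).intervalIntegrable (a := a) (b := 0)).1.union hIoi |>.mono_set ?_
  exact fun u hu => (le_or_gt u 0).imp (fun h => ⟨hu, h⟩) id

lemma expNegTail_tailProb_zero (hφ0 : 0 ≤ᵐ[ν] φ) (hint : Integrable φ ν) :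
    expNegTail (tailProb ν φ) 0 = Real.exp (-∫ z, φ z ∂ν) := by
  rw [expNegTail, hint.integral_eq_integral_meas_lt hφ0]
  rfl

/-- The conditional probability, given the first `N` points `(Γₖ, zₖ)`, that every point satisfies
`φ (zₖ) ≤ s + Γₖ`. -/
def voidWeight (ν : Measure S) (φ : S → ℝ) (N : ℕ) (s : ℝ) (w : (ℕ → ℝ) × (ℕ → S)) : ENNReal :=
  {w | ∀ k < N, φ (w.2 k) ≤ s + arrival w.1 k}.indicator 1 w *
    ENNReal.ofReal (expNegTail (tailProb ν φ) (s + ∑ j ∈ Finset.range N, w.1 j))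

lemma voidWeight_le_one (N : ℕ) (s : ℝ) (w : (ℕ → ℝ) × (ℕ → S)) : voidWeight ν φ N s w ≤ 1 :=
  mul_le_one' (indicator_le_self' (by simp) w)
    (ENNReal.ofReal_le_one.2 (expNegTail_le_one (tailProb_nonneg ν φ) _))

lemma voidWeight_succ (N : ℕ) (s : ℝ) (w : (ℕ → ℝ) × (ℕ → S)) :
    voidWeight ν φ (N + 1) s w = {z | φ z ≤ s + w.1 0}.indicator 1 (w.2 0) *
      voidWeight ν φ N (s + w.1 0) (fun n => w.1 (n + 1), fun n => w.2 (n + 1)) := by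
  have hevent : (∀ k < N + 1, φ (w.2 k) ≤ s + arrival w.1 k) ↔ φ (w.2 0) ≤ s + w.1 0 ∧
      ∀ k < N, φ (w.2 (k + 1)) ≤ s + w.1 0 + arrival (fun n => w.1 (n + 1)) k := by
    simp_rw [Nat.forall_lt_succ_left', arrival_succ_eq_add, add_assoc]
    simp [arrival]
  have hsum : s + ∑ j ∈ Finset.range (N + 1), w.1 j =
      s + w.1 0 + ∑ j ∈ Finset.range N, w.1 (j + 1) := by
    rw [Finset.sum_range_succ']; ring
  simp only [voidWeight, hsum, indicator_apply, mem_ofPred_eq, hevent, Pi.one_apply, ite_and,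
    ite_mul, one_mul, zero_mul]

lemma measurable_voidWeight (hφ : Measurable φ) (hG : Measurable (expNegTail (tailProb ν φ)))
    (N : ℕ) :
    Measurable fun q : ℝ × (ℕ → ℝ) × (ℕ → S) => voidWeight ν φ N q.1 q.2 := by
  have harr := measurable_arrival
  have hset : MeasurableSet {q : ℝ × (ℕ → ℝ) × (ℕ → S) |
      ∀ k < N, φ (q.2.2 k) ≤ q.1 + arrival q.2.1 k} := by
    simp only [ofPred_forall]
    exact .iInter fun k => .iInter fun _ => measurableSet_le (by fun_prop) (by fun_prop)
  exact (measurable_one.indicator hset).mul (by fun_prop)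

lemma lintegral_voidWeight [IsProbabilityMeasure ν] (hφ : Measurable φ) (hφ0 : 0 ≤ᵐ[ν] φ)
    (hint : Integrable φ ν) (N : ℕ) (s : ℝ) :
    ∫⁻ w, voidWeight ν φ N s w ∂markedLaw ν = ENNReal.ofReal (expNegTail (tailProb ν φ) s) := by
  have hT := integrableOn_tailProb_Ioi hφ0 hint
  have hG := (continuous_expNegTail hT).measurable
  induction N generalizing s with
  | zero => simp [voidWeight]
  | succ N ih =>
    have hind : Measurable fun q : ℝ × S => {z | φ z ≤ s + q.1}.indicator (1 : S → ENNReal) q.2 :=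
      measurable_one.indicator (measurableSet_le (f := fun q : ℝ × S => φ q.2) (by fun_prop)
        (by fun_prop : Measurable fun q : ℝ × S => s + q.1))
    have hW := measurable_voidWeight hφ hG N
    have hF : Measurable fun q : ℝ × S × (ℕ → ℝ) × (ℕ → S) =>
        {z | φ z ≤ s + q.1}.indicator 1 q.2.1 * voidWeight ν φ N (s + q.1) q.2.2 :=
      (hind.comp (measurable_fst.prodMk measurable_snd.fst)).mul
        (hW.comp ((measurable_fst.const_add s).prodMk measurable_snd.snd))
    have hmark : ∀ u, ∫⁻ z, {z | φ z ≤ u}.indicator (1 : S → ENNReal) z ∂ν =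
        ENNReal.ofReal (1 - tailProb ν φ u) := fun u => by
      rw [lintegral_indicator_one (measurableSet_le hφ measurable_const),
        measure_le_eq_ofReal_one_sub_tailProb hφ]
    calc ∫⁻ w, voidWeight ν φ (N + 1) s w ∂markedLaw ν
        = ∫⁻ e, ∫⁻ z, ∫⁻ w, {z | φ z ≤ s + e}.indicator 1 z * voidWeight ν φ N (s + e) w
            ∂markedLaw ν ∂ν ∂expMeasure 1 := by
          simp_rw [voidWeight_succ]
          exact lintegral_markedLaw_head_tail ν (F := fun e z w =>
            {z | φ z ≤ s + e}.indicator 1 z * voidWeight ν φ N (s + e) w) hF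
      _ = ∫⁻ e, ENNReal.ofReal (expNegTail (tailProb ν φ) (s + e) *
            (1 - tailProb ν φ (s + e))) ∂expMeasure 1 := by
          refine lintegral_congr fun e => ?_
          have hWe : Measurable (voidWeight ν φ N (s + e)) := by fun_prop
          have hinde : Measurable ({z | φ z ≤ s + e}.indicator (1 : S → ENNReal)) :=
            measurable_one.indicator (measurableSet_le hφ measurable_const)
          simp_rw [lintegral_const_mul _ hWe, ih]
          rw [lintegral_mul_const _ hinde, hmark, mul_comm,
            ENNReal.ofReal_mul (expNegTail_nonneg _ _)]
      _ = ENNReal.ofReal (expNegTail (tailProb ν φ) s) :=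
          lintegral_expNegTail_mul_one_sub hT (antitone_tailProb φ) (tailProb_nonneg ν φ)
            (tailProb_le_one φ) s

lemma measurableSet_forall_le_arrival (hφ : Measurable φ) :
    MeasurableSet {w : (ℕ → ℝ) × (ℕ → S) | ∀ k, φ (w.2 k) ≤ arrival w.1 k} := by
  have harr := measurable_arrival
  rw [ofPred_forall]
  exact .iInter fun k => measurableSet_le (by fun_prop) (by fun_prop)

lemma tendsto_voidWeight (hT : ∀ a, IntegrableOn (tailProb ν φ) (Ioi a))
    {w : (ℕ → ℝ) × (ℕ → S)}
    (hw : Tendsto (fun N => ∑ k ∈ Finset.range N, w.1 k) atTop atTop) :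
    Tendsto (fun N => voidWeight ν φ N 0 w) atTop
      (𝓝 ({w | ∀ k, φ (w.2 k) ≤ arrival w.1 k}.indicator 1 w)) := by
  by_cases hall : ∀ k, φ (w.2 k) ≤ arrival w.1 k
  · have hlim := ENNReal.tendsto_ofReal ((tendsto_expNegTail_atTop hT).comp hw)
    simpa [voidWeight, indicator_apply, hall] using! hlim
  · obtain ⟨k, hk⟩ := not_forall.1 hall
    refine tendsto_const_nhds.congr' ?_
    filter_upwards [eventually_gt_atTop k] with N hN
    have hnot : ¬ ∀ k < N, φ (w.2 k) ≤ arrival w.1 k := fun h => hk (h k hN)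
    simp [voidWeight, hall, hnot]

theorem markedLaw_forall_le [IsProbabilityMeasure ν] (hφ : Measurable φ) (hφ0 : 0 ≤ᵐ[ν] φ)
    (hint : Integrable φ ν) :
    markedLaw ν {w | ∀ k, φ (w.2 k) ≤ arrival w.1 k} =
      ENNReal.ofReal (Real.exp (-∫ z, φ z ∂ν)) := by
  have hT := integrableOn_tailProb_Ioi hφ0 hint
  have hW := measurable_voidWeight hφ (continuous_expNegTail hT).measurable
  have hlim : Tendsto (fun N => ∫⁻ w, voidWeight ν φ N 0 w ∂markedLaw ν) atTop
      (𝓝 (∫⁻ w, {w | ∀ k, φ (w.2 k) ≤ arrival w.1 k}.indicator 1 w ∂markedLaw ν)) :=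
    tendsto_lintegral_of_dominated_convergence (fun _ => 1)
      (fun N => (hW N).comp (measurable_const.prodMk measurable_id))
      (fun N => Eventually.of_forall (voidWeight_le_one N 0)) (by simp)
      ((ae_tendsto_sum_markedLaw ν).mono fun w hw => tendsto_voidWeight hT hw)
  simp_rw [lintegral_indicator_one (measurableSet_forall_le_arrival hφ),
    lintegral_voidWeight hφ hφ0 hint, expNegTail_tailProb_zero hφ0 hint] at hlim
  exact tendsto_nhds_unique hlim tendsto_const_nhds

lemma ae_forall_mark_markedLaw [IsProbabilityMeasure ν] {p : S → Prop} (hp : ∀ᵐ z ∂ν, p z) :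
    ∀ᵐ w ∂markedLaw ν, ∀ k, p (w.2 k) := by
  refine ae_all_iff.2 fun k => ?_
  exact ((measurePreserving_eval_infinitePi (fun _ : ℕ => ν) k).comp
    measurePreserving_snd).quasiMeasurePreserving.ae hp

lemma ae_exists_forall_le_mul_arrival [IsProbabilityMeasure ν] (hφ : Measurable φ)
    (hφ0 : 0 ≤ᵐ[ν] φ) (hint : Integrable φ ν) :
    ∀ᵐ w ∂markedLaw ν, ∃ c : ℝ, ∀ k, φ (w.2 k) ≤ c * arrival w.1 k := by
  -- The void probabilities of the scaled-down marks `φ / (n + 1)` tend to `1`.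
  set A : ℕ → Set ((ℕ → ℝ) × (ℕ → S)) := fun n => {w | ∀ k, φ (w.2 k) / (n + 1) ≤ arrival w.1 k}
  have hA : ∀ n, MeasurableSet (A n) := fun n =>
    measurableSet_forall_le_arrival (φ := fun z => φ z / (n + 1)) (by fun_prop)
  have hAprob : ∀ n, markedLaw ν (A n) =
      ENNReal.ofReal (Real.exp (-((∫ z, φ z ∂ν) / (n + 1)))) := fun n => by
    rw [← integral_div]
    exact markedLaw_forall_le (φ := fun z => φ z / (n + 1)) (by fun_prop)
      (hφ0.mono fun z hz => div_nonneg hz (by positivity)) (hint.div_const _)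
  have hlim : Tendsto (fun n => markedLaw ν (A n)) atTop (𝓝 1) := by
    have hdiv : Tendsto (fun n : ℕ => (∫ z, φ z ∂ν) / ((n : ℝ) + 1)) atTop (𝓝 0) :=
      tendsto_const_nhds.div_atTop
        (tendsto_atTop_add_const_right _ _ tendsto_natCast_atTop_atTop)
    simp_rw [hAprob]
    simpa using! ENNReal.tendsto_ofReal ((Real.continuous_exp.tendsto _).comp hdiv.neg)
  have hunion : markedLaw ν (⋃ n, A n) = 1 :=
    le_antisymm prob_le_one (le_of_tendsto' hlim fun n => measure_mono (subset_iUnion A n))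
  filter_upwards [(mem_ae_iff_prob_eq_one (.iUnion hA)).2 hunion] with w hw
  obtain ⟨n, hn⟩ := mem_iUnion.1 hw
  exact ⟨n + 1, fun k => (div_le_iff₀' (by positivity)).1 (hn k)⟩

end MarkedPoisson

section Ext

lemma iUnion_Iic_natCast_pi {ι : Type*} [Finite ι] :
    ⋃ n : ℕ, Iic (fun _ : ι => (n : ℝ)) = univ := by
  refine iUnion_eq_univ_iff.2 fun y => ?_
  obtain ⟨M, hM⟩ := (Set.finite_range y).bddAbove
  obtain ⟨n, hn⟩ := exists_nat_ge M
  exact ⟨n, fun a => (hM (mem_range_self a)).trans hn⟩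

theorem ext_of_forall_measure_Iic_pi {ι : Type*} [Finite ι] {μ μ' : Measure (ι → ℝ)}
    [IsFiniteMeasure μ] (h : ∀ x, μ (Iic x) = μ' (Iic x)) : μ = μ' := by
  have hpi : IsPiSystem (range fun x : ι → ℝ => Iic x) := by
    rintro _ ⟨x, rfl⟩ _ ⟨y, rfl⟩ -
    exact ⟨x ⊓ y, Iic_inter_Iic.symm⟩
  have himage : univ.pi '' univ.pi (fun _ : ι => range (Iic : ℝ → Set ℝ)) =
      range fun x : ι → ℝ => Iic x := by
    ext s
    constructor
    · rintro ⟨t, ht, rfl⟩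
      choose x hx using fun a => ht a (mem_univ a)
      exact ⟨x, by simp only [← pi_univ_Iic, hx]⟩
    · rintro ⟨x, rfl⟩
      exact ⟨fun a => Iic (x a), fun a _ => mem_range_self _, pi_univ_Iic x⟩
  have hgen : MeasurableSpace.generateFrom (range fun x : ι → ℝ => Iic x) =
      MeasurableSpace.pi := by
    rw [← himage]
    refine generateFrom_eq_pi (fun _ => (borel_eq_generateFrom_Iic ℝ).symm.trans
      (BorelSpace.measurable_eq (α := ℝ)).symm) fun _ => ?_
    exact ⟨fun n => Iic (n : ℝ), fun n => mem_range_self _,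
      iUnion_eq_univ_iff.2 exists_nat_ge⟩
  refine Measure.ext_of_generateFrom_of_iUnion _ (fun n : ℕ => Iic fun _ : ι => (n : ℝ))
    hgen.symm hpi iUnion_Iic_natCast_pi (fun n => mem_range_self _) (fun n => measure_ne_top _ _) ?_
  rintro _ ⟨x, rfl⟩
  exact h x

lemma tendsto_measure_Iic_add_one_div {ι : Type*} [Countable ι] (μ : Measure (ι → ℝ))
    [IsFiniteMeasure μ] (x : ι → ℝ) :
    Tendsto (fun n : ℕ => μ (Iic fun a => x a + 1 / ((n : ℝ) + 1))) atTop (𝓝 (μ (Iic x))) := by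
  have hinter : Iic x = ⋂ n : ℕ, Iic fun a => x a + 1 / ((n : ℝ) + 1) := by
    ext y
    simp only [mem_iInter, mem_Iic]
    refine ⟨fun hy n a => (hy a).trans (le_add_of_nonneg_right (by positivity)),
      fun hy a => ?_⟩
    have hlim := (tendsto_one_div_add_atTop_nhds_zero_nat (𝕜 := ℝ)).const_add (x a)
    rw [add_zero] at hlim
    exact ge_of_tendsto' hlim fun n => hy n a
  rw [hinter]
  refine tendsto_measure_iInter_atTop (fun n => measurableSet_Iic.nullMeasurableSet)
    (fun m n hmn => Iic_subset_Iic.2 fun a => ?_) ⟨0, measure_ne_top _ _⟩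
  gcongr

theorem ext_of_forall_pos_measure_Iic_pi {ι : Type*} [Finite ι] {μ μ' : Measure (ι → ℝ)}
    [IsFiniteMeasure μ] [IsFiniteMeasure μ'] (hμ : ∀ a, ∀ᵐ y ∂μ, 0 ≤ y a)
    (hμ' : ∀ a, ∀ᵐ y ∂μ', 0 ≤ y a)
    (h : ∀ x : ι → ℝ, (∀ a, 0 < x a) → μ (Iic x) = μ' (Iic x)) : μ = μ' := by
  refine ext_of_forall_measure_Iic_pi fun x => ?_
  by_cases hx : ∀ a, 0 ≤ x a
  · refine tendsto_nhds_unique (tendsto_measure_Iic_add_one_div μ x)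
      ((tendsto_measure_Iic_add_one_div μ' x).congr fun n => (h _ fun a => ?_).symm)
    exact add_pos_of_nonneg_of_pos (hx a) (by positivity)
  · obtain ⟨a, ha⟩ := not_forall.1 hx
    have hnull : ∀ {ρ : Measure (ι → ℝ)}, (∀ᵐ y ∂ρ, 0 ≤ y a) → ρ (Iic x) = 0 := fun hρ =>
      measure_eq_zero_iff_ae_notMem.2 (hρ.mono fun y h0 hy => ha (h0.trans (hy a)))
    rw [hnull (hμ a), hnull (hμ' a)]

theorem ext_of_forall_finset_map_eval {κ ι : Type*} {μ μ' : Measure (κ → ι → ℝ)}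
    [IsFiniteMeasure μ]
    (h : ∀ S : Finset (κ × ι), μ.map (fun f (a : S) => f a.1.1 a.1.2) =
      μ'.map (fun f (a : S) => f a.1.1 a.1.2)) : μ = μ' := by
  let e := MeasurableEquiv.curry κ ι ℝ
  refine e.symm.map_measurableEquiv_injective ?_
  have hproj : ∀ ρ : Measure (κ → ι → ℝ), IsProjectiveLimit (ρ.map e.symm)
      fun S : Finset (κ × ι) => ρ.map fun f (a : S) => f a.1.1 a.1.2 := fun ρ S => by
    rw [Measure.map_map (by fun_prop) (by fun_prop)]
    rfl
  have : ∀ S : Finset (κ × ι), IsFiniteMeasure (μ.map fun f (a : S) => f a.1.1 a.1.2) :=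
    fun S => inferInstance
  exact (hproj μ).unique (by simpa only [h] using hproj μ')

end Ext

section DeHaan

variable {p d : ℕ} {ι : Type*} [Finite ι]

lemma iSup_le_iff_of_nonneg {f : ι → ℝ} {y : ℝ} (hy : 0 ≤ y) : ⨆ a, f a ≤ y ↔ ∀ a, f a ≤ y :=
  ⟨fun h a => (le_ciSup (Set.finite_range f).bddAbove a).trans h, fun h => Real.iSup_le h hy⟩

lemma integrable_iSup_of_nonneg {S : Type*} [MeasurableSpace S] {ν : Measure S} {f : ι → S → ℝ}
    (hf0 : ∀ a, ∀ᵐ z ∂ν, 0 ≤ f a z) (hint : ∀ a, Integrable (f a) ν) :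
    Integrable (fun z => ⨆ a, f a z) ν := by
  cases nonempty_fintype ι
  refine Integrable.mono' (integrable_finsetSum Finset.univ fun a _ => hint a)
    (AEMeasurable.iSup fun a => (hint a).aemeasurable).aestronglyMeasurable ?_
  filter_upwards [ae_all_iff.2 hf0] with z hz
  rw [Real.norm_of_nonneg (Real.iSup_nonneg hz),
    iSup_le_iff_of_nonneg (Finset.sum_nonneg fun a _ => hz a)]
  exact fun a => Finset.single_le_sum (f := fun a => f a z) (fun a _ => hz a) (Finset.mem_univ a)

lemma rpow_neg_one_div_mul_le_iff {α g z x : ℝ} (hα : 0 < α) (hg : 0 < g) (hz : 0 ≤ z)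
    (hx : 0 < x) : g ^ (-1 / α) * z ≤ x ↔ z ^ α ≤ x ^ α * g := by
  have hpow : (g ^ (-1 / α) * z) ^ α = z ^ α / g := by
    rw [Real.mul_rpow (by positivity) hz, ← Real.rpow_mul hg.le, div_mul_cancel₀ _ hα.ne',
      Real.rpow_neg_one, inv_mul_eq_div]
  rw [← Real.rpow_le_rpow_iff (by positivity) hx.le hα, hpow, div_le_iff₀ hg]

lemma bddAbove_range_rpow_neg_one_div_mul {α c : ℝ} (hα : 0 < α) {g z : ℕ → ℝ}
    (hg : ∀ k, 0 < g k) (hz : ∀ k, 0 ≤ z k) (hc : ∀ k, z k ^ α ≤ c * g k) :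
    BddAbove (range fun k => g k ^ (-1 / α) * z k) := by
  have hb : 0 < max c 1 := by positivity
  refine ⟨max c 1 ^ (1 / α), ?_⟩
  rintro _ ⟨k, rfl⟩
  rw [rpow_neg_one_div_mul_le_iff hα (hg k) (hz k) (by positivity), ← Real.rpow_mul hb.le,
    one_div_mul_cancel hα.ne', Real.rpow_one]
  exact (hc k).trans (mul_le_mul_of_nonneg_right (le_max_left _ _) (hg k).le)

lemma measurableSet_forall_apply_le (τ : ι → Param p) (c : ι → Fin d) (x : ι → ℝ) :
    MeasurableSet {f : PathSpace p d | ∀ a, f (τ a) (c a) ≤ x a} := by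
  rw [ofPred_forall]
  exact .iInter fun a => measurableSet_le (by fun_prop) measurable_const

theorem deHaanLaw_forall_le {α : ℝ} (hα : 0 < α) (ν : Measure (PathSpace p d))
    [IsProbabilityMeasure ν] (hν0 : ∀ t i, ∀ᵐ z ∂ν, 0 ≤ z t i)
    (hint : ∀ t i, Integrable (fun z => z t i ^ α) ν)
    (τ : ι → Param p) (c : ι → Fin d) {x : ι → ℝ} (hx : ∀ a, 0 < x a) :
    deHaanLaw α ν {f | ∀ a, f (τ a) (c a) ≤ x a} =
      ENNReal.ofReal (Real.exp (-∫ z, ⨆ a, (z (τ a) (c a) / x a) ^ α ∂ν)) := by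
  have hνa : ∀ᵐ z ∂ν, ∀ a, 0 ≤ z (τ a) (c a) := ae_all_iff.2 fun a => hν0 _ _
  have hφ0 : ∀ a, ∀ᵐ z ∂ν, 0 ≤ (z (τ a) (c a) / x a) ^ α := fun a =>
    (hν0 _ _).mono fun z hz => Real.rpow_nonneg (div_nonneg hz (hx a).le) α
  have hφint : ∀ a, Integrable (fun z => (z (τ a) (c a) / x a) ^ α) ν := fun a =>
    ((hint (τ a) (c a)).div_const (x a ^ α)).congr <|
      (hν0 _ _).mono fun z hz => (Real.div_rpow hz (hx a).le α).symm
  rw [← markedLaw_forall_le (φ := fun z => ⨆ a, (z (τ a) (c a) / x a) ^ α)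
    (Measurable.iSup fun a => by fun_prop)
    ((ae_all_iff.2 hφ0).mono fun z hz => Real.iSup_nonneg hz)
    (integrable_iSup_of_nonneg hφ0 hφint),
    deHaanLaw, Measure.map_apply (measurable_deHaanMax α) (measurableSet_forall_apply_le τ c x)]
  refine measure_congr ?_
  have hbdd := ae_all_iff.2 fun a => ae_exists_forall_le_mul_arrival
    (φ := fun z : PathSpace p d => z (τ a) (c a) ^ α) (by fun_prop)
    ((hν0 _ _).mono fun z hz => Real.rpow_nonneg hz α) (hint (τ a) (c a))
  filter_upwards [hbdd, ae_arrival_pos ν, ae_forall_mark_markedLaw hνa] with w hw harr hz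
  refine propext ?_
  calc (∀ a, deHaanMax α w (τ a) (c a) ≤ x a)
      ↔ ∀ a k, arrival w.1 k ^ (-1 / α) * w.2 k (τ a) (c a) ≤ x a := forall_congr' fun a =>
        ciSup_le_iff <| bddAbove_range_rpow_neg_one_div_mul hα harr (fun k => hz k a)
          (hw a).choose_spec
    _ ↔ ∀ k a, (w.2 k (τ a) (c a) / x a) ^ α ≤ arrival w.1 k := by
        rw [forall_comm]
        refine forall₂_congr fun k a => ?_
        rw [rpow_neg_one_div_mul_le_iff hα (harr k) (hz k a) (hx a),
          Real.div_rpow (hz k a) (hx a).le, div_le_iff₀' (Real.rpow_pos_of_pos (hx a) α)]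
    _ ↔ ∀ k, ⨆ a, (w.2 k (τ a) (c a) / x a) ^ α ≤ arrival w.1 k :=
        forall_congr' fun k => (iSup_le_iff_of_nonneg (harr k).le).symm

instance isProbabilityMeasure_deHaanLaw (α : ℝ) (ν : Measure (PathSpace p d))
    [IsProbabilityMeasure ν] : IsProbabilityMeasure (deHaanLaw α ν) :=
  Measure.isProbabilityMeasure_map (μ := markedLaw ν) (measurable_deHaanMax α).aemeasurable

lemma ae_nonneg_deHaanLaw (α : ℝ) {ν : Measure (PathSpace p d)} [IsProbabilityMeasure ν]
    {t : Param p} {i : Fin d} (hν0 : ∀ᵐ z ∂ν, 0 ≤ z t i) :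
    ∀ᵐ f ∂deHaanLaw α ν, 0 ≤ f t i := by
  rw [deHaanLaw, ae_map_iff (measurable_deHaanMax α).aemeasurable
    (measurableSet_le measurable_const (by fun_prop))]
  filter_upwards [ae_arrival_pos ν, ae_forall_mark_markedLaw hν0] with w harr hz
  exact Real.iSup_nonneg fun k => mul_nonneg (Real.rpow_nonneg (harr k).le _) (hz k)

theorem deHaanLaw_eq_of_integral_iSup_eq {α : ℝ} (hα : 0 < α) {ν ν' : Measure (PathSpace p d)}
    [IsProbabilityMeasure ν] [IsProbabilityMeasure ν'] (hν0 : ∀ t i, ∀ᵐ z ∂ν, 0 ≤ z t i)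
    (hν0' : ∀ t i, ∀ᵐ z ∂ν', 0 ≤ z t i) (hint : ∀ t i, Integrable (fun z => z t i ^ α) ν)
    (hint' : ∀ t i, Integrable (fun z => z t i ^ α) ν')
    (h : ∀ (S : Finset (Param p × Fin d)) (x : S → ℝ), (∀ a, 0 < x a) →
      ∫ z, ⨆ a : S, (z a.1.1 a.1.2 / x a) ^ α ∂ν = ∫ z, ⨆ a : S, (z a.1.1 a.1.2 / x a) ^ α ∂ν') :
    deHaanLaw α ν = deHaanLaw α ν' := by
  refine ext_of_forall_finset_map_eval fun S => ?_
  have heval : Measurable fun (f : PathSpace p d) (a : S) => f a.1.1 a.1.2 := by fun_prop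
  have hnonneg : ∀ {ρ : Measure (PathSpace p d)} [IsProbabilityMeasure ρ],
      (∀ t i, ∀ᵐ z ∂ρ, 0 ≤ z t i) → ∀ a : S,
        ∀ᵐ y ∂(deHaanLaw α ρ).map (fun f (a : S) => f a.1.1 a.1.2), 0 ≤ y a := fun hρ a =>
    (ae_map_iff heval.aemeasurable (measurableSet_le measurable_const (by fun_prop))).2
      (ae_nonneg_deHaanLaw α (hρ _ _))
  refine ext_of_forall_pos_measure_Iic_pi (hnonneg hν0) (hnonneg hν0') fun x hx => ?_
  rw [Measure.map_apply heval measurableSet_Iic, Measure.map_apply heval measurableSet_Iic]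
  have hfdd := deHaanLaw_forall_le hα ν hν0 hint (fun a : S => a.1.1) (fun a => a.1.2) hx
  rw [h S x hx] at hfdd
  exact hfdd.trans
    (deHaanLaw_forall_le hα ν' hν0' hint' (fun a : S => a.1.1) (fun a => a.1.2) hx).symm

lemma measurable_comp_pathSpace {q : ℕ} (σ : Param q → Param p) :
    Measurable fun f : PathSpace p d => f ∘ σ :=
  measurable_pi_lambda _ fun t => measurable_pi_apply (σ t)

lemma map_comp_deHaanLaw {q : ℕ} (α : ℝ) (ν : Measure (PathSpace p d)) [IsProbabilityMeasure ν]
    (σ : Param q → Param p) :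
    (deHaanLaw α ν).map (fun f => f ∘ σ) = deHaanLaw α (ν.map fun f => f ∘ σ) := by
  have hσ := measurable_comp_pathSpace (d := d) σ
  have hσseq : Measurable fun (z : ℕ → PathSpace p d) k => z k ∘ σ := by fun_prop
  have hmarks : (Measure.infinitePi fun _ : ℕ => ν).map (fun z k => z k ∘ σ) =
      Measure.infinitePi fun _ : ℕ => ν.map fun f => f ∘ σ :=
    Measure.infinitePi_map_pi (fun _ => ν) fun _ => hσ
  rw [deHaanLaw, deHaanLaw, ← hmarks, ← Measure.map_id (μ := Measure.infinitePi _),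
    Measure.map_prod_map _ _ measurable_id hσseq, Measure.map_id,
    Measure.map_map hσ (measurable_deHaanMax α),
    Measure.map_map (measurable_deHaanMax α) (measurable_id.prodMap hσseq)]
  rfl

end DeHaan

section Gaussian

variable {Ω : Type*} [MeasurableSpace Ω] {Q : Measure Ω}

lemma mgf_of_hasGaussianLaw {S : Ω → ℝ} (hS : HasGaussianLaw S Q) (t : ℝ) :
    mgf S Q t = Real.exp ((∫ ω, S ω ∂Q) * t + Var[S; Q] * t ^ 2 / 2) := by
  rw [mgf_gaussianReal hS.map_eq_gaussianReal, Real.coe_toNNReal _ (variance_nonneg _ _)]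

lemma integrable_exp_of_hasGaussianLaw {S : Ω → ℝ} (hS : HasGaussianLaw S Q) :
    Integrable (fun ω => Real.exp (S ω)) Q := by
  have := hS.isProbabilityMeasure
  have hpos : 0 < mgf S Q 1 := (mgf_of_hasGaussianLaw hS 1).symm ▸ Real.exp_pos _
  simpa only [one_mul] using mgf_pos_iff.1 hpos

lemma integral_exp_of_hasGaussianLaw {S : Ω → ℝ} (hS : HasGaussianLaw S Q) :
    ∫ ω, Real.exp (S ω) ∂Q = Real.exp ((∫ ω, S ω ∂Q) + Var[S; Q] / 2) := by
  simpa only [mgf, one_mul, mul_one, one_pow] using mgf_of_hasGaussianLaw hS 1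

lemma map_eq_of_mgf_eq {Ω' : Type*} [MeasurableSpace Ω'] {Q' : Measure Ω'}
    [IsProbabilityMeasure Q] [IsFiniteMeasure Q'] {S : Ω → ℝ} {S' : Ω' → ℝ}
    (hS : AEMeasurable S Q) (hS' : AEMeasurable S' Q') (h : mgf S Q = mgf S' Q')
    (hexp : integrableExpSet S Q = univ) : Q.map S = Q'.map S' := by
  refine Measure.ext_of_complexMGF_eq hS hS' (funext fun z => ?_)
  exact eqOn_complexMGF_of_mgf h (by simp [hexp])

lemma mgf_tilted_of_hasGaussianLaw {S R : Ω → ℝ} (hSR : HasGaussianLaw (fun ω => (S ω, R ω)) Q)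
    (t : ℝ) : mgf S (Q.tilted R) t =
      Real.exp (((∫ ω, S ω ∂Q) + cov[S, R; Q]) * t + Var[S; Q] * t ^ 2 / 2) := by
  have := hSR.isProbabilityMeasure
  have hS := hSR.fst
  have hR := hSR.snd
  have hsum : HasGaussianLaw (fun ω => t * S ω + R ω) Q :=
    hSR.map_fun (t • ContinuousLinearMap.fst ℝ ℝ ℝ + ContinuousLinearMap.snd ℝ ℝ ℝ)
  have hmean : ∫ ω, (t * S ω + R ω) ∂Q = t * (∫ ω, S ω ∂Q) + ∫ ω, R ω ∂Q := by
    rw [integral_add (hS.integrable.const_mul t) hR.integrable, integral_const_mul]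
  have hvar : Var[fun ω => t * S ω + R ω; Q] =
      t ^ 2 * Var[S; Q] + 2 * (t * cov[S, R; Q]) + Var[R; Q] := by
    rw [variance_fun_add (hS.memLp_two.const_mul t) hR.memLp_two, variance_const_mul,
      covariance_const_mul_left]
  calc mgf S (Q.tilted R) t
      = (∫ ω, Real.exp (t * S ω + R ω) ∂Q) / ∫ ω, Real.exp (R ω) ∂Q := by
        rw [mgf, integral_tilted, ← integral_div]
        refine integral_congr_ae (.of_forall fun ω => ?_)
        simp only [smul_eq_mul, Real.exp_add]
        ring
    _ = _ := by
        rw [integral_exp_of_hasGaussianLaw hsum, integral_exp_of_hasGaussianLaw hR, hmean, hvar,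
          ← Real.exp_sub]
        congr 1
        ring

lemma map_tilted_real_of_hasGaussianLaw {S R : Ω → ℝ}
    (hSR : HasGaussianLaw (fun ω => (S ω, R ω)) Q) :
    (Q.tilted R).map S = Q.map fun ω => S ω + cov[S, R; Q] := by
  have := hSR.isProbabilityMeasure
  have := isProbabilityMeasure_tilted (integrable_exp_of_hasGaussianLaw hSR.snd)
  have hS := hSR.fst
  refine map_eq_of_mgf_eq (hS.aemeasurable.mono_ac (tilted_absolutelyContinuous _ _))
    (hS.aemeasurable.add_const _) (funext fun t => ?_)
    (eq_univ_of_forall fun t => mgf_pos_iff.1 ?_)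
  · rw [mgf_tilted_of_hasGaussianLaw hSR, mgf_add_const, mgf_of_hasGaussianLaw hS, ← Real.exp_add]
    congr 1
    ring
  · rw [mgf_tilted_of_hasGaussianLaw hSR]
    exact Real.exp_pos _

section Vector

variable {E : Type*} [NormedAddCommGroup E] [NormedSpace ℝ E] [CompleteSpace E]
  [SecondCountableTopology E] [MeasurableSpace E] [BorelSpace E]

theorem map_tilted_of_hasGaussianLaw {X : Ω → E} {R : Ω → ℝ}
    (hXR : HasGaussianLaw (fun ω => (X ω, R ω)) Q) {m : E}
    (hm : ∀ L : StrongDual ℝ E, L m = cov[fun ω => L (X ω), R; Q]) :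
    (Q.tilted R).map X = Q.map fun ω => X ω + m := by
  have := hXR.isProbabilityMeasure
  have := isProbabilityMeasure_tilted (integrable_exp_of_hasGaussianLaw hXR.snd)
  have hX : AEMeasurable X (Q.tilted R) :=
    hXR.fst.aemeasurable.mono_ac (tilted_absolutelyContinuous _ _)
  have hXm : AEMeasurable (fun ω => X ω + m) Q := hXR.fst.aemeasurable.add_const m
  refine Measure.ext_of_charFunDual (funext fun L => ?_)
  have hLR : HasGaussianLaw (fun ω => (L (X ω), R ω)) Q :=
    hXR.map_fun (L.prodMap (ContinuousLinearMap.id ℝ ℝ))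
  rw [charFunDual_eq_charFun_map_one, charFunDual_eq_charFun_map_one,
    AEMeasurable.map_map_of_aemeasurable (by fun_prop) hX,
    AEMeasurable.map_map_of_aemeasurable (by fun_prop) hXm]
  simpa only [Function.comp_def, map_add, hm] using
    congrArg (charFun · 1) (map_tilted_real_of_hasGaussianLaw hLR)

theorem integral_exp_mul_of_hasGaussianLaw {X : Ω → E} {R : Ω → ℝ}
    (hXR : HasGaussianLaw (fun ω => (X ω, R ω)) Q) {m : E}
    (hm : ∀ L : StrongDual ℝ E, L m = cov[fun ω => L (X ω), R; Q]) (hR0 : ∫ ω, R ω ∂Q = 0)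
    {f : E → ℝ} (hf : Measurable f) :
    ∫ ω, Real.exp (R ω - Var[R; Q] / 2) * f (X ω) ∂Q = ∫ ω, f (X ω + m) ∂Q := by
  have hX : AEMeasurable X (Q.tilted R) :=
    hXR.fst.aemeasurable.mono_ac (tilted_absolutelyContinuous _ _)
  have hXm : AEMeasurable (fun ω => X ω + m) Q := hXR.fst.aemeasurable.add_const m
  rw [← integral_map hXm hf.aestronglyMeasurable, ← map_tilted_of_hasGaussianLaw hXR hm,
    integral_map hX hf.aestronglyMeasurable, integral_tilted,
    integral_exp_of_hasGaussianLaw hXR.snd, hR0]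
  simp only [Real.exp_sub, zero_add, smul_eq_mul]

end Vector

section Coordinates

variable {ι : Type*} [Finite ι] {X : ι → Ω → ℝ}

lemma exists_dual_apply_eq_sum {κ : Type*} [Fintype κ] (L : StrongDual ℝ (κ → ℝ)) :
    ∃ u : κ → ℝ, ∀ y, L y = ∑ a, y a * u a := by
  classical
  exact ⟨_, (L : (κ → ℝ) →ₗ[ℝ] ℝ).pi_apply_eq_sum_univ⟩

lemma covariance_dual_apply [IsFiniteMeasure Q] (hX : ∀ a, MemLp (X a) 2 Q) {R : Ω → ℝ}
    (hR : MemLp R 2 Q) (L : StrongDual ℝ (ι → ℝ)) :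
    cov[fun ω => L fun a => X a ω, R; Q] = L fun a => cov[X a, R; Q] := by
  cases nonempty_fintype ι
  obtain ⟨u, hu⟩ := exists_dual_apply_eq_sum L
  simp_rw [hu]
  rw [covariance_fun_sum_left (fun a => (hX a).mul_const _) hR]
  simp_rw [covariance_mul_const_left]

theorem integral_exp_eval_mul_of_hasGaussianLaw (hX : HasGaussianLaw (fun ω a => X a ω) Q) (a : ι)
    (h0 : ∫ ω, X a ω ∂Q = 0) {f : (ι → ℝ) → ℝ} (hf : Measurable f) :
    ∫ ω, Real.exp (X a ω - Var[X a; Q] / 2) * f (fun b => X b ω) ∂Q =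
      ∫ ω, f (fun b => X b ω + cov[X b, X a; Q]) ∂Q := by
  cases nonempty_fintype ι
  have := hX.isProbabilityMeasure
  have hXa : HasGaussianLaw (fun ω => (fun b => X b ω, X a ω)) Q :=
    hX.map_fun ((ContinuousLinearMap.id ℝ _).prod (ContinuousLinearMap.proj a))
  exact integral_exp_mul_of_hasGaussianLaw hXa
    (fun L => (covariance_dual_apply (fun b => (hX.eval b).memLp_two)
      (hX.eval a).memLp_two L).symm) h0 hf

theorem map_eq_of_hasGaussianLaw_of_covariance_eq {Ω' : Type*} [MeasurableSpace Ω']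
    {Q' : Measure Ω'} {X' : ι → Ω' → ℝ} (hX : HasGaussianLaw (fun ω a => X a ω) Q)
    (hX' : HasGaussianLaw (fun ω a => X' a ω) Q')
    (hmean : ∀ a, ∫ ω, X a ω ∂Q = ∫ ω, X' a ω ∂Q')
    (hcov : ∀ a b, cov[X a, X b; Q] = cov[X' a, X' b; Q']) :
    Q.map (fun ω a => X a ω) = Q'.map (fun ω a => X' a ω) := by
  cases nonempty_fintype ι
  have := hX.isGaussian_map
  have := hX'.isGaussian_map
  have := hX.isProbabilityMeasure
  have := hX'.isProbabilityMeasure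
  refine Measure.ext_of_charFunDual (funext fun L => ?_)
  obtain ⟨u, hu⟩ := exists_dual_apply_eq_sum L
  have hmeanL : ∫ ω, L (fun a => X a ω) ∂Q = ∫ ω, L (fun a => X' a ω) ∂Q' := by
    simp_rw [hu]
    rw [integral_finsetSum _ fun a _ => (hX.eval a).integrable.mul_const _,
      integral_finsetSum _ fun a _ => (hX'.eval a).integrable.mul_const _]
    simp_rw [integral_mul_const, hmean]
  have hvarL : Var[fun ω => L fun a => X a ω; Q] = Var[fun ω => L fun a => X' a ω; Q'] := by
    simp_rw [hu]
    rw [variance_fun_sum fun a => (hX.eval a).memLp_two.mul_const _,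
      variance_fun_sum fun a => (hX'.eval a).memLp_two.mul_const _]
    simp_rw [covariance_mul_const_left, covariance_mul_const_right, hcov]
  rw [hX.charFunDual_map_eq_fun, hX'.charFunDual_map_eq_fun, hmeanL, hvarL]

lemma covariance_sub_sub_eq_variance_sub [IsFiniteMeasure Q] {S T U : Ω → ℝ} (hS : MemLp S 2 Q)
    (hT : MemLp T 2 Q) (hU : MemLp U 2 Q) :
    cov[fun ω => S ω - U ω, fun ω => T ω - U ω; Q] =
      (Var[fun ω => S ω - U ω; Q] + Var[fun ω => T ω - U ω; Q] -
        Var[fun ω => S ω - T ω; Q]) / 2 := by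
  have h := variance_fun_sub (hS.sub hU) (hT.sub hU)
  simp only [Pi.sub_apply, sub_sub_sub_cancel_right] at h
  rw [h]
  simp only [Pi.sub_def]
  ring

theorem map_sub_eq_of_variance_sub_eq {Ω' : Type*} [MeasurableSpace Ω'] {Q' : Measure Ω'}
    {X' : ι → Ω' → ℝ} (hX : HasGaussianLaw (fun ω a => X a ω) Q) (h0 : ∀ a, ∫ ω, X a ω ∂Q = 0)
    (hX' : HasGaussianLaw (fun ω a => X' a ω) Q') (h0' : ∀ a, ∫ ω, X' a ω ∂Q' = 0)
    (hvar : ∀ a b, Var[fun ω => X a ω - X b ω; Q] = Var[fun ω => X' a ω - X' b ω; Q']) (a : ι) :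
    Q.map (fun ω b => X b ω - X a ω) = Q'.map (fun ω b => X' b ω - X' a ω) := by
  cases nonempty_fintype ι
  have := hX.isProbabilityMeasure
  have := hX'.isProbabilityMeasure
  let D : (ι → ℝ) →L[ℝ] (ι → ℝ) := ContinuousLinearMap.pi fun b =>
    ContinuousLinearMap.proj (R := ℝ) (φ := fun _ : ι => ℝ) b - ContinuousLinearMap.proj a
  have hmem := fun b => (hX.eval b).memLp_two
  have hmem' := fun b => (hX'.eval b).memLp_two
  have hint := fun b => (hX.eval b).integrable
  have hint' := fun b => (hX'.eval b).integrable
  refine map_eq_of_hasGaussianLaw_of_covariance_eq (hX.map_fun D) (hX'.map_fun D)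
    (fun b => ?_) (fun b c => ?_)
  · rw [integral_sub (hint b) (hint a), integral_sub (hint' b) (hint' a)]
    simp only [h0, h0']
  · rw [covariance_sub_sub_eq_variance_sub (hmem b) (hmem c) (hmem a),
      covariance_sub_sub_eq_variance_sub (hmem' b) (hmem' c) (hmem' a), hvar, hvar, hvar]

lemma ae_ne_of_variance_ne_zero {S : Ω → ℝ} (hS : HasGaussianLaw S Q) (hvar : Var[S; Q] ≠ 0)
    (r : ℝ) : ∀ᵐ ω ∂Q, S ω ≠ r := by
  have := nullSingletonClass_gaussianReal (μ := ∫ ω, S ω ∂Q)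
    (Real.toNNReal_pos.2 ((variance_nonneg S Q).lt_of_ne' hvar)).ne'
  refine ae_of_ae_map (p := fun y => y ≠ r) hS.aemeasurable ?_
  rw [hS.map_eq_gaussianReal]
  exact Measure.ae_ne _ r

end Coordinates

end Gaussian

section Exponent

variable {Ω ι : Type*} [MeasurableSpace Ω] {Q : Measure Ω} {X : ι → Ω → ℝ} {x : ι → ℝ}

/-- The exponent function `x ↦ E max_b exp (X_b - Var(X_b) / 2) / x_b` of the max-stable law with
unit Fréchet margins whose spectral vector is the log-Gaussian vector built from `X`; its negative
exponential is the distribution function of that law. -/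
def logGaussianExponent (X : ι → Ω → ℝ) (Q : Measure Ω) (x : ι → ℝ) : ℝ :=
  ∫ ω, ⨆ b, Real.exp (X b ω - Var[X b; Q] / 2) / x b ∂Q

lemma logGaussianExponent_eq_integral_sub [Finite ι] (hX : HasGaussianLaw (fun ω a => X a ω) Q)
    (a : ι) (h0 : ∫ ω, X a ω ∂Q = 0) (x : ι → ℝ) :
    logGaussianExponent X Q x =
      ∫ ω, ⨆ b, Real.exp (X b ω - X a ω - Var[fun ω => X b ω - X a ω; Q] / 2) / x b ∂Q := by
  have := hX.isProbabilityMeasure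
  have hvar : ∀ b, Var[fun ω => X b ω - X a ω; Q] =
      Var[X b; Q] - 2 * cov[X b, X a; Q] + cov[X a, X a; Q] := fun b => by
    rw [variance_fun_sub (hX.eval b).memLp_two (hX.eval a).memLp_two,
      covariance_self (hX.eval a).aemeasurable]
  let f : (ι → ℝ) → ℝ := fun y =>
    ⨆ b, Real.exp (y b - y a - (Var[X b; Q] - Var[X a; Q]) / 2) / x b
  calc logGaussianExponent X Q x
      = ∫ ω, Real.exp (X a ω - Var[X a; Q] / 2) * f (fun b => X b ω) ∂Q := by
        refine integral_congr_ae (.of_forall fun ω => ?_)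
        simp only [f, Real.mul_iSup_of_nonneg (Real.exp_pos _).le, mul_div_assoc', ← Real.exp_add]
        refine iSup_congr fun b => ?_
        ring_nf
    _ = ∫ ω, f (fun b => X b ω + cov[X b, X a; Q]) ∂Q :=
        integral_exp_eval_mul_of_hasGaussianLaw hX a h0 (.iSup fun b => by fun_prop)
    _ = _ := by
        refine integral_congr_ae (.of_forall fun ω => iSup_congr fun b => ?_)
        simp only [hvar, covariance_self (hX.eval a).aemeasurable]
        ring_nf

theorem logGaussianExponent_eq_of_variance_sub_eq [Finite ι] {Ω' : Type*} [MeasurableSpace Ω']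
    {Q' : Measure Ω'} {X' : ι → Ω' → ℝ}
    (hX : HasGaussianLaw (fun ω a => X a ω) Q) (h0 : ∀ a, ∫ ω, X a ω ∂Q = 0)
    (hX' : HasGaussianLaw (fun ω a => X' a ω) Q') (h0' : ∀ a, ∫ ω, X' a ω ∂Q' = 0)
    (hvar : ∀ a b, Var[fun ω => X a ω - X b ω; Q] = Var[fun ω => X' a ω - X' b ω; Q'])
    (x : ι → ℝ) : logGaussianExponent X Q x = logGaussianExponent X' Q' x := by
  rcases isEmpty_or_nonempty ι with hι | ⟨⟨a⟩⟩
  · simp [logGaussianExponent]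
  have hinc : AEMeasurable (fun ω b => X b ω - X a ω) Q := aemeasurable_pi_lambda _ fun b =>
    (hX.eval b).aemeasurable.sub (hX.eval a).aemeasurable
  have hinc' : AEMeasurable (fun ω b => X' b ω - X' a ω) Q' := aemeasurable_pi_lambda _ fun b =>
    (hX'.eval b).aemeasurable.sub (hX'.eval a).aemeasurable
  have hmap := map_sub_eq_of_variance_sub_eq hX h0 hX' h0' hvar a
  let f : (ι → ℝ) → ℝ := fun y =>
    ⨆ b, Real.exp (y b - Var[fun ω => X b ω - X a ω; Q] / 2) / x b
  have hf : Measurable f := .iSup fun b => by fun_prop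
  calc logGaussianExponent X Q x
      = ∫ ω, f (fun b => X b ω - X a ω) ∂Q := logGaussianExponent_eq_integral_sub hX a (h0 a) x
    _ = ∫ ω, f (fun b => X' b ω - X' a ω) ∂Q' := by
        rw [← integral_map hinc hf.aestronglyMeasurable, hmap,
          integral_map hinc' hf.aestronglyMeasurable]
    _ = logGaussianExponent X' Q' x := by
        rw [logGaussianExponent_eq_integral_sub hX' a (h0' a)]
        simp only [f, hvar]

lemma iSup_eq_sum_of_injective [Fintype ι] {f : ι → ℝ} (hf : Function.Injective f) :
    ⨆ a, f a = ∑ a, f a * {y : ι → ℝ | ∀ b, b ≠ a → y b ≤ y a}.indicator 1 f := by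
  rcases isEmpty_or_nonempty ι with hι | hι
  · simp
  obtain ⟨a, ha⟩ := Finite.exists_max f
  have hsup : ⨆ b, f b = f a :=
    le_antisymm (ciSup_le ha) (le_ciSup (Set.finite_range f).bddAbove a)
  rw [hsup, Finset.sum_eq_single_of_mem a (Finset.mem_univ a) fun b _ hb => ?_,
    indicator_of_mem (by exact fun b _ => ha b), Pi.one_apply, mul_one]
  rw [indicator_of_notMem, mul_zero]
  exact fun h => hb (hf (le_antisymm (ha b) (h a hb.symm)))

lemma measurableSet_forall_ne_le [Countable ι] (a : ι) :
    MeasurableSet {y : ι → ℝ | ∀ b, b ≠ a → y b ≤ y a} := by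
  simp only [ofPred_forall]
  exact .iInter fun b => .iInter fun _ => measurableSet_le (by fun_prop) (by fun_prop)

lemma exp_div_le_exp_div_iff {u v r s : ℝ} (hr : 0 < r) (hs : 0 < s) :
    Real.exp u / r ≤ Real.exp v / s ↔ u - v ≤ Real.log (r / s) := by
  rw [Real.le_log_iff_exp_le (by positivity), Real.exp_sub, div_le_div_iff₀ hr hs,
    div_le_div_iff₀ (Real.exp_pos v) hs, mul_comm r]

lemma ae_injective_exp_div [Finite ι] (hX : HasGaussianLaw (fun ω a => X a ω) Q)
    (hvar : ∀ a b, a ≠ b → Var[fun ω => X a ω - X b ω; Q] ≠ 0) (hx : ∀ a, 0 < x a) :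
    ∀ᵐ ω ∂Q, Function.Injective fun b => Real.exp (X b ω - Var[X b; Q] / 2) / x b := by
  cases nonempty_fintype ι
  have hne : ∀ᵐ ω ∂Q, ∀ a b, a ≠ b → X a ω - X b ω ≠
      Real.log (x a / x b) + (Var[X a; Q] - Var[X b; Q]) / 2 := by
    refine ae_all_iff.2 fun a => ae_all_iff.2 fun b => ?_
    by_cases hab : a = b
    · simp [hab]
    · exact (ae_ne_of_variance_ne_zero (hX.prodMk a b).fun_sub (hvar a b hab) _).mono
        fun ω hω _ => hω
  filter_upwards [hne] with ω hω a b hab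
  by_contra hne
  have hle := (exp_div_le_exp_div_iff (hx a) (hx b)).1 hab.le
  have hge := (exp_div_le_exp_div_iff (hx b) (hx a)).1 hab.ge
  rw [Real.log_div (hx _).ne' (hx _).ne'] at hle hge
  refine hω a b hne ?_
  rw [Real.log_div (hx _).ne' (hx _).ne']
  linarith

lemma integrable_exp_div_mul_indicator [Finite ι] (hX : HasGaussianLaw (fun ω a => X a ω) Q)
    (x : ι → ℝ) (a : ι) : Integrable (fun ω => Real.exp (X a ω - Var[X a; Q] / 2) / x a *
      {y : ι → ℝ | ∀ b, b ≠ a → y b ≤ y a}.indicator 1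
        fun b => Real.exp (X b ω - Var[X b; Q] / 2) / x b) Q := by
  cases nonempty_fintype ι
  have hexp : Integrable (fun ω => Real.exp (X a ω - Var[X a; Q] / 2) / x a) Q := by
    simp only [Real.exp_sub]
    exact ((integrable_exp_of_hasGaussianLaw (hX.eval a)).div_const _).div_const _
  have hvec : AEMeasurable (fun ω b => Real.exp (X b ω - Var[X b; Q] / 2) / x b) Q :=
    aemeasurable_pi_lambda _ fun b =>
      (((hX.eval b).aemeasurable.sub_const _).exp).div_const _
  refine hexp.mul_bdd (c := 1) ((measurable_one.indicator
    (measurableSet_forall_ne_le a)).comp_aemeasurable hvec).aestronglyMeasurable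
    (.of_forall fun ω => ?_)
  exact (norm_indicator_le_norm_self _ _).trans (by simp)

lemma integral_exp_div_mul_indicator [Finite ι] (hX : HasGaussianLaw (fun ω a => X a ω) Q)
    {a : ι} (h0 : ∫ ω, X a ω ∂Q = 0) (hx : ∀ b, 0 < x b) :
    ∫ ω, Real.exp (X a ω - Var[X a; Q] / 2) / x a *
      {y : ι → ℝ | ∀ b, b ≠ a → y b ≤ y a}.indicator 1
        (fun b => Real.exp (X b ω - Var[X b; Q] / 2) / x b) ∂Q =
    1 / x a * Q.real {ω | ∀ b, b ≠ a →
      X b ω - X a ω - Var[fun ω => X b ω - X a ω; Q] / 2 ≤ Real.log (x b / x a)} := by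
  cases nonempty_fintype ι
  have := hX.isProbabilityMeasure
  set A : Set (ι → ℝ) := {y | ∀ b, b ≠ a → y b ≤ y a}
  let g : (ι → ℝ) → ι → ℝ := fun y b => Real.exp (y b - Var[X b; Q] / 2) / x b
  have hg : Measurable g := by fun_prop
  have hgA : MeasurableSet (g ⁻¹' A) := hg (measurableSet_forall_ne_le a)
  have hshift : AEMeasurable (fun ω b => X b ω + cov[X b, X a; Q]) Q :=
    aemeasurable_pi_lambda _ fun b => (hX.eval b).aemeasurable.add_const _
  have hset : (fun ω b => X b ω + cov[X b, X a; Q]) ⁻¹' (g ⁻¹' A) = {ω | ∀ b, b ≠ a →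
      X b ω - X a ω - Var[fun ω => X b ω - X a ω; Q] / 2 ≤ Real.log (x b / x a)} := by
    ext ω
    refine forall₂_congr fun b _ => ?_
    simp only [g]
    rw [exp_div_le_exp_div_iff (hx b) (hx a), covariance_self (hX.eval a).aemeasurable,
      variance_fun_sub (hX.eval b).memLp_two (hX.eval a).memLp_two]
    ring_nf
  calc _ = 1 / x a * ∫ ω, Real.exp (X a ω - Var[X a; Q] / 2) *
        (g ⁻¹' A).indicator 1 (fun b => X b ω) ∂Q := by
        rw [← integral_const_mul]
        refine integral_congr_ae (.of_forall fun ω => ?_)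
        simp only [div_mul_eq_mul_div, one_mul]
        rfl
    _ = 1 / x a * ∫ ω, (g ⁻¹' A).indicator 1 (fun b => X b ω + cov[X b, X a; Q]) ∂Q := by
        rw [integral_exp_eval_mul_of_hasGaussianLaw hX a h0 (measurable_one.indicator hgA)]
    _ = _ := by
        rw [← integral_map hshift (measurable_one.indicator hgA).aestronglyMeasurable,
          integral_indicator_one hgA, map_measureReal_apply_of_aemeasurable hshift hgA, hset]

theorem logGaussianExponent_eq_sum [Fintype ι] (hX : HasGaussianLaw (fun ω a => X a ω) Q)
    (h0 : ∀ a, ∫ ω, X a ω ∂Q = 0) (hvar : ∀ a b, a ≠ b → Var[fun ω => X a ω - X b ω; Q] ≠ 0)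
    (hx : ∀ a, 0 < x a) :
    logGaussianExponent X Q x = ∑ a, 1 / x a * Q.real {ω | ∀ b, b ≠ a →
      X b ω - X a ω - Var[fun ω => X b ω - X a ω; Q] / 2 ≤ Real.log (x b / x a)} := by
  calc logGaussianExponent X Q x
      = ∫ ω, ∑ a, Real.exp (X a ω - Var[X a; Q] / 2) / x a *
          {y : ι → ℝ | ∀ b, b ≠ a → y b ≤ y a}.indicator 1
            (fun b => Real.exp (X b ω - Var[X b; Q] / 2) / x b) ∂Q :=
        integral_congr_ae ((ae_injective_exp_div hX hvar hx).mono
          fun ω hω => iSup_eq_sum_of_injective hω)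
    _ = _ := by
        rw [integral_finsetSum _ fun a _ => integrable_exp_div_mul_indicator hX x a]
        exact Finset.sum_congr rfl fun a _ => integral_exp_div_mul_indicator hX (h0 a) hx

end Exponent

section BrownResnickLaw

variable {p d : ℕ} {Ω Ω' : Type*} [MeasurableSpace Ω] [MeasurableSpace Ω']
  {P : Measure Ω} {Q : Measure Ω'} {X : Param p → Ω → Fin d → ℝ} {Y : Param p → Ω' → Fin d → ℝ}

lemma hasGaussianLaw_eval_pi {ι : Type*} [Finite ι] (hY : IsGaussianProcess Y Q) (τ : ι → Param p)
    (c : ι → Fin d) : HasGaussianLaw (fun ω a => Y (τ a) ω (c a)) Q := by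
  classical
  cases nonempty_fintype ι
  let L : (Finset.univ.image τ → Fin d → ℝ) →L[ℝ] (ι → ℝ) := ContinuousLinearMap.pi fun a =>
    (ContinuousLinearMap.proj (R := ℝ) (φ := fun _ : Fin d => ℝ) (c a)).comp
      (ContinuousLinearMap.proj (R := ℝ) (φ := fun _ : Finset.univ.image τ => Fin d → ℝ)
        ⟨τ a, by simp⟩)
  exact (hY.hasGaussianLaw (Finset.univ.image τ)).map_fun L

lemma measurable_exp_sub_pathSpace (v : Param p → Fin d → ℝ) :
    Measurable fun (f : PathSpace p d) t i => Real.exp (f t i - v t i / 2) := by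
  fun_prop

lemma aemeasurable_logGaussian (hY : AEMeasurable (fun ω t => Y t ω) Q) :
    AEMeasurable (fun ω t => logGaussian Y Q t ω) Q :=
  (measurable_exp_sub_pathSpace fun t i => Var[fun ω => Y t ω i; Q]).comp_aemeasurable hY

lemma ae_nonneg_processLaw_logGaussian (hY : AEMeasurable (fun ω t => Y t ω) Q) (t : Param p)
    (i : Fin d) : ∀ᵐ z ∂processLaw (logGaussian Y Q) Q, 0 ≤ z t i :=
  (ae_map_iff (aemeasurable_logGaussian hY)
    (measurableSet_le measurable_const (by fun_prop))).2 (.of_forall fun _ => (Real.exp_pos _).le)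

lemma integrable_processLaw_logGaussian (hY : IsGaussianProcess Y Q)
    (hYm : AEMeasurable (fun ω t => Y t ω) Q) (t : Param p) (i : Fin d) :
    Integrable (fun z => z t i ^ (1 : ℝ)) (processLaw (logGaussian Y Q) Q) := by
  have hexp := integrable_exp_of_hasGaussianLaw ((hY.hasGaussianLaw_eval t).eval i)
  simp only [Real.rpow_one]
  rw [processLaw, integrable_map_measure (Measurable.aestronglyMeasurable (by fun_prop))
    (aemeasurable_logGaussian hYm)]
  simpa only [← Real.exp_sub] using! hexp.div_const (Real.exp (Var[fun ω => Y t ω i; Q] / 2))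

lemma integral_processLaw_logGaussian {ι : Type*} [Countable ι]
    (hY : AEMeasurable (fun ω t => Y t ω) Q) (τ : ι → Param p) (c : ι → Fin d) (x : ι → ℝ) :
    ∫ z, ⨆ a, (z (τ a) (c a) / x a) ^ (1 : ℝ) ∂processLaw (logGaussian Y Q) Q =
      logGaussianExponent (fun a ω => Y (τ a) ω (c a)) Q x := by
  simp only [Real.rpow_one]
  rw [processLaw, integral_map (aemeasurable_logGaussian hY)
    (Measurable.iSup fun a => by fun_prop).aestronglyMeasurable]
  rfl

/-- `X` has the law of the Brown–Resnick process built from the centered Gaussian process `Y`; in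
contrast to `IsBrownResnick`, nothing is assumed about individual sample paths. -/
structure HasBrownResnickLaw (X : Param p → Ω → Fin d → ℝ) (P : Measure Ω)
    (Y : Param p → Ω' → Fin d → ℝ) (Q : Measure Ω') : Prop where
  gaussian : IsGaussianProcess Y Q
  aemeasurable_gaussian : AEMeasurable (fun ω t => Y t ω) Q
  centered : ∀ t i, ∫ ω, Y t ω i ∂Q = 0
  law_eq : processLaw X P = deHaanLaw 1 (processLaw (logGaussian Y Q) Q)

namespace HasBrownResnickLaw

lemma isProbabilityMeasure_spectral (h : HasBrownResnickLaw X P Y Q) :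
    IsProbabilityMeasure (processLaw (logGaussian Y Q) Q) :=
  have := h.gaussian.isProbabilityMeasure
  Measure.isProbabilityMeasure_map (aemeasurable_logGaussian h.aemeasurable_gaussian)

lemma aemeasurable (h : HasBrownResnickLaw X P Y Q) : AEMeasurable (fun ω t => X t ω) P := by
  have := h.isProbabilityMeasure_spectral
  refine AEMeasurable.of_map_ne_zero ?_
  change processLaw X P ≠ 0
  rw [h.law_eq]
  exact IsProbabilityMeasure.ne_zero _

theorem measure_forall_le {ι : Type*} [Finite ι] (h : HasBrownResnickLaw X P Y Q)
    (τ : ι → Param p) (c : ι → Fin d) {x : ι → ℝ} (hx : ∀ a, 0 < x a) :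
    P {ω | ∀ a, X (τ a) ω (c a) ≤ x a} =
      ENNReal.ofReal (Real.exp (-logGaussianExponent (fun a ω => Y (τ a) ω (c a)) Q x)) := by
  have := h.isProbabilityMeasure_spectral
  have hYm := h.aemeasurable_gaussian
  rw [← integral_processLaw_logGaussian hYm, ← deHaanLaw_forall_le one_pos _
    (ae_nonneg_processLaw_logGaussian hYm) (integrable_processLaw_logGaussian h.gaussian hYm)
    τ c hx, ← h.law_eq, processLaw,
    Measure.map_apply_of_aemeasurable h.aemeasurable (measurableSet_forall_apply_le τ c x)]
  rfl

theorem processLaw_eq_of_crossVariogram_eq {Ω₁ Ω₁' : Type*} [MeasurableSpace Ω₁]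
    [MeasurableSpace Ω₁'] {P₁ : Measure Ω₁} {Q₁ : Measure Ω₁'} {X₁ : Param p → Ω₁ → Fin d → ℝ}
    {Y₁ : Param p → Ω₁' → Fin d → ℝ} (h : HasBrownResnickLaw X P Y Q)
    (h₁ : HasBrownResnickLaw X₁ P₁ Y₁ Q₁)
    (hvar : ∀ i j t s, crossVariogram Y Q i j t s = crossVariogram Y₁ Q₁ i j t s) :
    processLaw X P = processLaw X₁ P₁ := by
  have := h.isProbabilityMeasure_spectral
  have := h₁.isProbabilityMeasure_spectral
  have hYm := h.aemeasurable_gaussian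
  have hYm₁ := h₁.aemeasurable_gaussian
  rw [h.law_eq, h₁.law_eq]
  refine deHaanLaw_eq_of_integral_iSup_eq one_pos (ae_nonneg_processLaw_logGaussian hYm)
    (ae_nonneg_processLaw_logGaussian hYm₁) (integrable_processLaw_logGaussian h.gaussian hYm)
    (integrable_processLaw_logGaussian h₁.gaussian hYm₁) fun S x _ => ?_
  rw [integral_processLaw_logGaussian hYm (fun a : S => a.1.1) (fun a => a.1.2),
    integral_processLaw_logGaussian hYm₁ (fun a : S => a.1.1) (fun a => a.1.2)]
  exact logGaussianExponent_eq_of_variance_sub_eq (hasGaussianLaw_eval_pi h.gaussian _ _)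
    (fun a => h.centered _ _) (hasGaussianLaw_eval_pi h₁.gaussian _ _)
    (fun a => h₁.centered _ _) (fun a b => hvar _ _ _ _) x

lemma comp_right {q : ℕ} (h : HasBrownResnickLaw X P Y Q) (σ : Param q → Param p) :
    HasBrownResnickLaw (X ∘ σ) P (Y ∘ σ) Q where
  gaussian := h.gaussian.comp_right σ
  aemeasurable_gaussian :=
    (measurable_comp_pathSpace σ).comp_aemeasurable h.aemeasurable_gaussian
  centered t := h.centered (σ t)
  law_eq := by
    have := h.isProbabilityMeasure_spectral
    calc processLaw (X ∘ σ) P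
        = (processLaw X P).map fun f => f ∘ σ :=
          (AEMeasurable.map_map_of_aemeasurable (measurable_comp_pathSpace σ).aemeasurable
            h.aemeasurable).symm
      _ = deHaanLaw 1 ((processLaw (logGaussian Y Q) Q).map fun f => f ∘ σ) := by
          rw [h.law_eq, map_comp_deHaanLaw]
      _ = deHaanLaw 1 (processLaw (logGaussian (Y ∘ σ) Q) Q) := by
          rw [processLaw, AEMeasurable.map_map_of_aemeasurable
            (measurable_comp_pathSpace σ).aemeasurable
            (aemeasurable_logGaussian h.aemeasurable_gaussian)]
          rfl

theorem isStationary (h : HasBrownResnickLaw X P Y Q) {g : Fin d → Fin d → Param p → ℝ}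
    (hg : ∀ i j t s, crossVariogram Y Q i j t s = g i j (t - s)) : IsStationary X P := fun u =>
  (h.comp_right (· - u)).processLaw_eq_of_crossVariogram_eq h fun i j t s =>
    (hg i j (t - u) (s - u)).trans (by rw [sub_sub_sub_cancel_right, hg])

theorem measureReal_forall_le {ι : Type*} [Fintype ι] (h : HasBrownResnickLaw X P Y Q)
    (τ : ι → Param p) (c : ι → Fin d) {x : ι → ℝ} (hx : ∀ a, 0 < x a)
    (hvar : ∀ a b, a ≠ b → crossVariogram Y Q (c a) (c b) (τ a) (τ b) ≠ 0) :
    P.real {ω | ∀ a, X (τ a) ω (c a) ≤ x a} = Real.exp (-∑ a, 1 / x a * Q.real {ω | ∀ b, b ≠ a →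
      Y (τ b) ω (c b) - Y (τ a) ω (c a) - Var[fun ω => Y (τ b) ω (c b) - Y (τ a) ω (c a); Q] / 2 ≤
        Real.log (x b / x a)}) := by
  rw [measureReal_def, h.measure_forall_le τ c hx, ENNReal.toReal_ofReal (Real.exp_pos _).le,
    logGaussianExponent_eq_sum (hasGaussianLaw_eval_pi h.gaussian τ c)
      (fun a => h.centered _ _) hvar hx]

theorem measureReal_forall_forall_le {ι : Type*} [Fintype ι] (h : HasBrownResnickLaw X P Y Q)
    (t : ι → Param p) {x : ι → Fin d → ℝ} (hx : ∀ j i, 0 < x j i)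
    (hvar : ∀ i k j l, (i, j) ≠ (k, l) → crossVariogram Y Q i k (t j) (t l) ≠ 0) :
    P.real {ω | ∀ j i, X (t j) ω i ≤ x j i} =
      Real.exp (-∑ k, ∑ l, 1 / x l k * Q.real {ω | ∀ i j, (i, j) ≠ (k, l) →
        Y (t j) ω i - Y (t l) ω k - Var[fun ω => Y (t j) ω i - Y (t l) ω k; Q] / 2 ≤
          Real.log (x j i / x l k)}) := by
  have hfdd := h.measureReal_forall_le (fun a : Fin d × ι => t a.2) Prod.fst
    (x := fun a => x a.2 a.1) (fun a => hx _ _) fun a b hab => hvar _ _ _ _ hab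
  simp only [Fintype.sum_prod_type, Prod.forall] at hfdd
  simp only [forall_comm (α := ι)]
  exact hfdd

end HasBrownResnickLaw

lemma IsBrownResnick.hasBrownResnickLaw (h : IsBrownResnick X P Y Q) :
    HasBrownResnickLaw X P Y Q where
  gaussian := h.gaussian
  aemeasurable_gaussian := by
    refine (measurable_pi_lambda _ fun t => measurable_pi_lambda _ fun i => ?_).aemeasurable
    have hexp := (measurable_pi_apply i).comp (h.maxStable.spectral_paths.measurable t)
    simpa [logGaussian, Function.comp_def] using
      (Real.measurable_log.comp hexp).add_const (Var[fun ω => Y t ω i; Q] / 2)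
  centered := h.centered
  law_eq := h.maxStable.law_eq

end BrownResnickLaw

section Density

lemma addHaar_setOf_linearMap_eq {E : Type*} [NormedAddCommGroup E] [NormedSpace ℝ E]
    [FiniteDimensional ℝ E] [MeasurableSpace E] [BorelSpace E] (μ : Measure E)
    [μ.IsAddHaarMeasure] {L : E →ₗ[ℝ] ℝ} (hL : L ≠ 0) (r : ℝ) : μ {v | L v = r} = 0 := by
  let s : AffineSubspace ℝ E := (AffineSubspace.mk' r ⊥).comap L.toAffineMap
  have hs : (s : Set E) = {v | L v = r} := by
    ext v
    simp [s, AffineSubspace.mem_mk', sub_eq_zero]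
  rw [← hs]
  refine Measure.addHaar_affineSubspace μ s fun htop => hL (LinearMap.ext fun v => ?_)
  have hconst : ∀ v, L v = r := fun v => by
    have hv : v ∈ (s : Set E) := htop ▸ AffineSubspace.mem_top ℝ E v
    rwa [hs] at hv
  rw [hconst v, ← hconst 0, map_zero, LinearMap.zero_apply]

lemma variance_ne_zero_of_hasPDF {Ω E : Type*} [MeasurableSpace Ω] {Q : Measure Ω}
    [IsFiniteMeasure Q] [NeZero Q] [NormedAddCommGroup E] [NormedSpace ℝ E]
    [FiniteDimensional ℝ E] [MeasurableSpace E] [BorelSpace E] {μ : Measure E}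
    [μ.IsAddHaarMeasure] {V : Ω → E} (hV : HasPDF V Q μ) {L : E →ₗ[ℝ] ℝ} (hL : L ≠ 0)
    (hmem : MemLp (fun ω => L (V ω)) 2 Q) : Var[fun ω => L (V ω); Q] ≠ 0 := fun hvar => by
  have hconst := ae_eq_integral_of_variance_eq_zero hmem hvar
  have hne : ∀ᵐ ω ∂Q, L (V ω) ≠ ∫ ω, L (V ω) ∂Q := ae_of_ae_map hV.aemeasurable <|
    measure_eq_zero_iff_ae_notMem.1 <|
      hV.absolutelyContinuous (addHaar_setOf_linearMap_eq μ hL (∫ ω, L (V ω) ∂Q))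
  obtain ⟨ω, hω, hω'⟩ := (hne.and hconst).exists
  exact hω hω'

lemma exists_linearMap_ne_zero_apply_eq_sub {ι κ : Type*} {i k : κ} {j l : ι}
    (hne : (i, j) ≠ (k, l)) :
    ∃ L : (ι → κ → ℝ) →ₗ[ℝ] ℝ, L ≠ 0 ∧ ∀ v, L v = v j i - v l k := by
  classical
  let coord (i : κ) (j : ι) : (ι → κ → ℝ) →ₗ[ℝ] ℝ :=
    (LinearMap.proj i : (κ → ℝ) →ₗ[ℝ] ℝ).comp (LinearMap.proj j)
  refine ⟨coord i j - coord k l, fun hzero => ?_, fun v => rfl⟩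
  let e : ι → κ → ℝ := Pi.single j (Pi.single i 1)
  have hval : e j i - e l k = 0 := LinearMap.congr_fun hzero e
  have hoff : e l k = 0 := by
    rcases eq_or_ne l j with rfl | hl
    · simp only [e, Pi.single_eq_same]
      exact Pi.single_eq_of_ne (fun hk => hne (by rw [hk])) 1
    · simp only [e, Pi.single_eq_of_ne hl, Pi.zero_apply]
  simp [hoff, e] at hval

lemma crossVariogram_ne_zero_of_hasPDF {p d : ℕ} {Ω ι : Type*} [MeasurableSpace Ω] [Fintype ι]
    {Q : Measure Ω} {Y : Param p → Ω → Fin d → ℝ} (hY : IsGaussianProcess Y Q) {t : ι → Param p}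
    (hpdf : HasPDF (fun ω j i => Y (t j) ω i) Q volume) {i k : Fin d} {j l : ι}
    (hne : (i, j) ≠ (k, l)) : crossVariogram Y Q i k (t j) (t l) ≠ 0 := by
  have := hY.isProbabilityMeasure
  have : (volume : Measure (Fin d → ℝ)).IsAddHaarMeasure := Measure.pi.isAddHaarMeasure _
  have : (volume : Measure (ι → Fin d → ℝ)).IsAddHaarMeasure :=
    Measure.pi.isAddHaarMeasure fun _ => volume
  have hmem : ∀ i j, MemLp (fun ω => Y (t j) ω i) 2 Q := fun i j =>
    ((hY.hasGaussianLaw_eval (t j)).eval i).memLp_two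
  obtain ⟨L, hL, happly⟩ := exists_linearMap_ne_zero_apply_eq_sub hne
  have hvar := variance_ne_zero_of_hasPDF hpdf hL
    (by simpa only [happly] using! (hmem i j).sub (hmem k l))
  simpa only [happly] using! hvar

end Density

end BrownResnick

end

theorem mainTheorem3_general {p d : ℕ} {Ω Ω' : Type*} [MeasurableSpace Ω] [MeasurableSpace Ω']
    {P : Measure Ω} {Q : Measure Ω'} {X : BrownResnick.Param p → Ω → Fin d → ℝ}
    {Y : BrownResnick.Param p → Ω' → Fin d → ℝ} (hX : BrownResnick.HasBrownResnickLaw X P Y Q) :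
    (∀ {Ω₁ Ω₁' : Type*} [MeasurableSpace Ω₁] [MeasurableSpace Ω₁'] {P₁ : Measure Ω₁}
      {Q₁ : Measure Ω₁'} {X₁ : BrownResnick.Param p → Ω₁ → Fin d → ℝ}
      {Y₁ : BrownResnick.Param p → Ω₁' → Fin d → ℝ},
      BrownResnick.HasBrownResnickLaw X₁ P₁ Y₁ Q₁ →
      (∀ i j t s, BrownResnick.crossVariogram Y Q i j t s =
        BrownResnick.crossVariogram Y₁ Q₁ i j t s) →
      BrownResnick.processLaw X P = BrownResnick.processLaw X₁ P₁) ∧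
    ((∃ g : Fin d → Fin d → BrownResnick.Param p → ℝ,
        ∀ i j t s, BrownResnick.crossVariogram Y Q i j t s = g i j (t - s)) →
      BrownResnick.IsStationary X P) ∧
    (∀ (n : ℕ) (t : Fin n → BrownResnick.Param p) (x : Fin n → Fin d → ℝ),
      (∀ j i, 0 < x j i) →
      (∀ i k j l, (i, j) ≠ (k, l) → BrownResnick.crossVariogram Y Q i k (t j) (t l) ≠ 0) →
      0 < P.real {ω | ∀ j i, X (t j) ω i ≤ x j i} ∧
      -Real.log (P.real {ω | ∀ j i, X (t j) ω i ≤ x j i}) =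
        ∑ k : Fin d, ∑ l : Fin n, 1 / x l k *
          Q.real {ω | ∀ (i : Fin d) (j : Fin n), (i, j) ≠ (k, l) →
            Y (t j) ω i - Y (t l) ω k -
                variance (fun ω' => Y (t j) ω' i - Y (t l) ω' k) Q / 2
              ≤ Real.log (x j i / x l k)}) := by
  refine ⟨hX.processLaw_eq_of_crossVariogram_eq, fun ⟨g, hg⟩ => hX.isStationary hg,
    fun n t x hx hvar => ?_⟩
  rw [hX.measureReal_forall_forall_le t hx hvar, Real.log_exp, neg_neg]
  exact ⟨Real.exp_pos _, rfl⟩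

theorem mainTheorem3 {p d : ℕ} {Ω Ω' : Type*} [MeasurableSpace Ω] [MeasurableSpace Ω']
    (P : Measure Ω) [IsProbabilityMeasure P] (Q : Measure Ω') [IsProbabilityMeasure Q]
    (X : BrownResnick.Param p → Ω → Fin d → ℝ) (Y : BrownResnick.Param p → Ω' → Fin d → ℝ)
    (hX : BrownResnick.IsBrownResnick X P Y Q) :
    -- the law of `X` depends only on the cross-variograms
    (∀ {Ω₁ Ω₁' : Type*} [MeasurableSpace Ω₁] [MeasurableSpace Ω₁']
      (P₁ : Measure Ω₁) [IsProbabilityMeasure P₁] (Q₁ : Measure Ω₁') [IsProbabilityMeasure Q₁]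
      (X₁ : BrownResnick.Param p → Ω₁ → Fin d → ℝ) (Y₁ : BrownResnick.Param p → Ω₁' → Fin d → ℝ),
      BrownResnick.IsBrownResnick X₁ P₁ Y₁ Q₁ →
      (∀ i j t s, BrownResnick.crossVariogram Y Q i j t s =
        BrownResnick.crossVariogram Y₁ Q₁ i j t s) →
      BrownResnick.processLaw X P = BrownResnick.processLaw X₁ P₁) ∧
    -- stationarity
    ((∃ g : Fin d → Fin d → BrownResnick.Param p → ℝ,
        ∀ i j t s, BrownResnick.crossVariogram Y Q i j t s = g i j (t - s)) →
      BrownResnick.IsStationary X P) ∧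
    -- the finite-dimensional distributions
    (∀ (n : ℕ) (t : Fin n → BrownResnick.Param p) (x : Fin n → Fin d → ℝ),
      (∀ j i, 0 < x j i) →
      HasPDF (fun ω (j : Fin n) (i : Fin d) => Y (t j) ω i) Q volume →
      0 < P.real {ω | ∀ j i, X (t j) ω i ≤ x j i} ∧
      -Real.log (P.real {ω | ∀ j i, X (t j) ω i ≤ x j i}) =
        ∑ k : Fin d, ∑ l : Fin n, 1 / x l k *
          Q.real {ω | ∀ (i : Fin d) (j : Fin n), (i, j) ≠ (k, l) →
            Y (t j) ω i - Y (t l) ω k -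
                variance (fun ω' => Y (t j) ω' i - Y (t l) ω' k) Q / 2
              ≤ Real.log (x j i / x l k)}) := by
  obtain ⟨hlaw, hstat, hfdd⟩ := mainTheorem3_general hX.hasBrownResnickLaw
  exact ⟨fun _ _ _ _ _ _ hX₁ => hlaw hX₁.hasBrownResnickLaw, hstat, fun n t x hx hpdf =>
    hfdd n t x hx fun _ _ _ _ => BrownResnick.crossVariogram_ne_zero_of_hasPDF hX.gaussian hpdf⟩
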